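/- Let $G$ be a finite group and let $K_0(\mathrm{f.}G\text{-}\mathrm{s.})$ be the Grothendieck (Burnside) ring of finite $G$-sets, with its pre-$\lambda$-structure $\sigma$ determined by $\sigma_{[A]}(t)=1+[A]t+[S^2A]t^2+\cdots$ for finite $G$-sets $A$ (where $S^kA=A^k/S_k$) and by $\sigma_{a+b}=\sigma_a\sigma_b$. Any $A(t)\in 1+t\,K_0(\mathrm{f.}G\text{-}\mathrm{s.})[[t]]$ has a unique representation $A(t)=\prod_{i\ge1}\sigma_{b_i}(t^i)$, and one puts $A(t)^{a}:=\prod_{i\ge 1}\sigma_{ab_i}(t^i)$ for $a\in K_0(\mathrm{f.}G\text{-}\mathrm{s.})$; in particular $(1-t^m)^{-a}=\sigma_a(t^m)$. Let $X$ be a Hausdorff space on which $G$ acts by homeomorphisms and let $\varphi:X\to X$ be a continuous $G$-equivariant map. Cohomology $H^*$ means either ordinary singular cohomology or singular cohomology with compact supports (the same choice throughout); in the second case it is also assumed that the preimage under $\varphi$ of each compact set is compact, so that $\varphi$ acts on cohomology. Assume that $H^*(X/G;\mathbb Z)$ is a finitely generated graded group. For a self-map $f$ of a pair $(Z,A)$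 acting on cohomology put $L(f_{|(Z,A)})=\sum_n(-1)^n\,\mathrm{tr}(f^*\mid H^n(Z,A;\mathbb Z)/\mathrm{torsion})$, and $L(f)=L(f_{|(Z,\emptyset)})$. For $f:Y\to Y$ let the integers $s_m(f)$, $m\ge1$, be defined by $L(f^m)=\sum_{i\mid m}s_i(f)$, and let $$\zeta_f(t)=\prod_{m\ge1}(1-t^m)^{-s_m(f)/m}.$$ For a conjugacy class $\mathfrak H$ of subgroups of $G$ let $X^{\mathfrak H}$ be the set of points of $X$ fixed by some subgroup in $\mathfrak H$, and let $X^{>\mathfrak H}=\bigcup_{\mathfrak H'>\mathfrak H}X^{\mathfrak H'}$. Let $$\widetilde L^G(\varphi)=\sum_{\mathfrak H}L\bigl(\varphi_{|(X^{\mathfrak H}/G,\;X^{>\mathfrak H}/G)}\bigr)\,[G/H]\in K_0(\mathrm{f.}G\text{-}\mathrm{s.}),$$ where $\mathfrak H$ runs over all conjugacy classes of subgroups of $G$ and $H\in\mathfrak H$. Let $\widetilde s{}^G_m$ be defined by $\widetilde L^G(\varphi^m)=\sum_{i\mid m}\widetilde s{}^G_i$, and let $$\widetilde\zeta{}^G_\varphi(t)=\prod_{m\ge1}(1-t^m)^{-\widetilde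 s{}^G_m/m}.$$ Suppose that the isotropy subgroups of all points of $X$ belong to a single conjugacy class $\mathfrak H$ of subgroups of $G$, and let $H$ be any representative of $\mathfrak H$. Then, for every $m\ge1$, the integer $s_m(\varphi_{|X/G})$ is divisible by $m$ in $\mathbb Z$ and $\widetilde s{}^G_m$ is divisible by $m$ in $K_0(\mathrm{f.}G\text{-}\mathrm{s.})$, in both cases with a unique quotient (so that both zeta functions are well defined), and $$\widetilde\zeta{}^G_\varphi(t)=\bigl(\zeta_{\varphi_{|X/G}}(t)\bigr)^{[G/H]},$$ where $\varphi_{|X/G}:X/G\to X/G$ is the map induced by $\varphi$, and the integer coefficients of $\zeta_{\varphi_{|X/G}}$ are regarded as elements of $K_0(\mathrm{f.}G\text{-}\mathrm{s.})$. -/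

import Mathlib

open scoped TensorProduct

universe u v

noncomputable section

/-! ## Finite `G`-sets and the Burnside ring -/

/-- A finite set with a left action of the group `G`. -/
structure FinGSet (G : Type u) [Group G] : Type (u + 1) where
  carrier : Type u
  [fin : Finite carrier]
  [act : MulAction G carrier]

namespace FinGSet

attribute [instance] FinGSet.fin FinGSet.act

variable {G : Type u} [Group G]

/-- Isomorphism of finite `G`-sets. -/
def Iso (A B : FinGSet G) : Prop :=
  ∃ e : A.carrier ≃ B.carrier, ∀ (g : G) (a : A.carrier), e (g • a) = g • e a

theorem Iso.refl (A : FinGSet G) : Iso A A := ⟨Equiv.refl _, fun _ _ => rfl⟩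

theorem Iso.symm {A B : FinGSet G} : Iso A B → Iso B A := by
  rintro ⟨e, he⟩
  refine ⟨e.symm, fun g b => ?_⟩
  rw [Equiv.symm_apply_eq, he, Equiv.apply_symm_apply]

theorem Iso.trans {A B C : FinGSet G} : Iso A B → Iso B C → Iso A C := by
  rintro ⟨e, he⟩ ⟨f, hf⟩
  exact ⟨e.trans f, fun g a => by simp [he, hf]⟩

instance setoid : Setoid (FinGSet G) := ⟨Iso, Iso.refl, Iso.symm, Iso.trans⟩

/-- The empty `G`-set. -/
def empty : FinGSet G :=
  { carrier := PEmpty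
    act := { smul := fun _ a => a, one_smul := fun _ => rfl, mul_smul := fun _ _ _ => rfl } }

/-- The one-point `G`-set. -/
def point : FinGSet G :=
  { carrier := PUnit
    act := { smul := fun _ a => a, one_smul := fun _ => rfl, mul_smul := fun _ _ _ => rfl } }

/-- The disjoint union of two finite `G`-sets. -/
def sum (A B : FinGSet G) : FinGSet G :=
  { carrier := A.carrier ⊕ B.carrier
    act :=
      { smul := fun g => Sum.map (g • ·) (g • ·)
        one_smul := by
          rintro (a | b)
          · exact congrArg Sum.inl (one_smul G a)
          · exact congrArg Sum.inr (one_smul G b)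
        mul_smul := by
          rintro g h (a | b)
          · exact congrArg Sum.inl (mul_smul g h a)
          · exact congrArg Sum.inr (mul_smul g h b) } }

/-- The cartesian product of two finite `G`-sets, with the diagonal action. -/
def prod (A B : FinGSet G) : FinGSet G :=
  { carrier := A.carrier × B.carrier }

/-- The symmetric power `S^n A = A^n / S_n` with the induced action. -/
def sym (n : ℕ) (A : FinGSet G) : FinGSet G :=
  { carrier := Sym A.carrier n
    fin := by
      classical
      have := Fintype.ofFinite A.carrier
      infer_instance
    act :=
      { smul := fun g s => s.map (g • ·)
        one_smul := fun s => by
          change s.map (fun a => (1 : G) • a) = s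
          simp
        mul_smul := fun g h s => by
          change s.map (fun a => (g * h) • a) = (s.map (h • ·)).map (g • ·)
          simp [Sym.map_map, mul_smul] } }

/-- The invariant subset of a finite `G`-set cut out by an invariant property. -/
def sub (A : FinGSet G) (p : A.carrier → Prop) (hp : ∀ (g : G) a, p a → p (g • a)) :
    FinGSet G :=
  { carrier := {a // p a}
    act :=
      { smul := fun g a => ⟨g • a.1, hp g a.1 a.2⟩
        one_smul := fun a => Subtype.ext (one_smul G a.1)
        mul_smul := fun g h a => Subtype.ext (mul_smul g h a.1) } }

/-- The transitive `G`-set `G / H`. -/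
def coset [Finite G] (H : Subgroup G) : FinGSet G :=
  { carrier := G ⧸ H }

theorem Iso.sum {A B C D : FinGSet G} : Iso A B → Iso C D → Iso (sum A C) (sum B D) := by
  rintro ⟨e, he⟩ ⟨f, hf⟩
  refine ⟨Equiv.sumCongr e f, ?_⟩
  rintro g (a | c)
  · exact congrArg Sum.inl (he g a)
  · exact congrArg Sum.inr (hf g c)

theorem Iso.prod {A B C D : FinGSet G} : Iso A B → Iso C D → Iso (prod A C) (prod B D) := by
  rintro ⟨e, he⟩ ⟨f, hf⟩
  refine ⟨Equiv.prodCongr e f, ?_⟩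
  rintro g ⟨a, c⟩
  exact Prod.ext (he g a) (hf g c)

theorem Iso.sym {A B : FinGSet G} (n : ℕ) : Iso A B → Iso (sym n A) (sym n B) := by
  rintro ⟨e, he⟩
  refine ⟨Sym.equivCongr e, fun g s => ?_⟩
  have key : ∀ x : Sym A.carrier n,
      Sym.map e (Sym.map (fun a => g • a) x) = Sym.map (fun b => g • b) (Sym.map e x) := by
    intro x
    rw [Sym.map_map, Sym.map_map]
    exact Sym.map_congr fun a _ => he g a
  exact key s

end FinGSet

namespace SumMultiset

variable {α β : Type*}

/-- The multiset on a disjoint union with given restrictions to the two summands. -/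
def join (s : Multiset α) (t : Multiset β) : Multiset (α ⊕ β) := s.map Sum.inl + t.map Sum.inr

/-- The restriction of a multiset on a disjoint union to the left summand. -/
def left (m : Multiset (α ⊕ β)) : Multiset α := m.filterMap Sum.getLeft?

/-- The restriction of a multiset on a disjoint union to the right summand. -/
def right (m : Multiset (α ⊕ β)) : Multiset β := m.filterMap Sum.getRight?

@[simp] theorem left_cons_inl (a : α) (m : Multiset (α ⊕ β)) :
    left (Sum.inl a ::ₘ m) = a ::ₘ left m := Multiset.filterMap_cons_some _ _ _ rfl

@[simp] theorem left_cons_inr (b : β) (m : Multiset (α ⊕ β)) :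
    left (Sum.inr b ::ₘ m) = left m := Multiset.filterMap_cons_none _ _ rfl

@[simp] theorem right_cons_inl (a : α) (m : Multiset (α ⊕ β)) :
    right (Sum.inl a ::ₘ m) = right m := Multiset.filterMap_cons_none _ _ rfl

@[simp] theorem right_cons_inr (b : β) (m : Multiset (α ⊕ β)) :
    right (Sum.inr b ::ₘ m) = b ::ₘ right m := Multiset.filterMap_cons_some _ _ _ rfl

theorem card_join (s : Multiset α) (t : Multiset β) :
    Multiset.card (join s t) = Multiset.card s + Multiset.card t := by
  simp [join]

theorem join_left_right (m : Multiset (α ⊕ β)) : join (left m) (right m) = m := by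
  induction m using Multiset.induction_on with
  | empty => rfl
  | cons z m ih =>
    conv_rhs => rw [← ih]
    rcases z with a | b <;> simp [join]

theorem left_join (s : Multiset α) (t : Multiset β) : left (join s t) = s := by
  induction s using Multiset.induction_on with
  | empty =>
    induction t using Multiset.induction_on with
    | empty => rfl
    | cons b t ih => simpa [join] using ih
  | cons a s ih => simpa [join] using ih

theorem right_join (s : Multiset α) (t : Multiset β) : right (join s t) = t := by
  induction s using Multiset.induction_on with
  | empty =>
    induction t using Multiset.induction_on with
    | empty => rfl
    | cons b t ih => simpa [join] using ih
  | cons a s ih => simpa [join] using ih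

theorem join_map {γ δ : Type*} (u : α → γ) (v : β → δ) (s : Multiset α) (t : Multiset β) :
    join (s.map u) (t.map v) = (join s t).map (Sum.map u v) := by
  simp [join, Multiset.map_map, Function.comp_def]

theorem left_map {γ δ : Type*} (u : α → γ) (v : β → δ) (m : Multiset (α ⊕ β)) :
    left (m.map (Sum.map u v)) = (left m).map u := by
  rw [← join_left_right m, ← join_map, left_join, left_join]

theorem right_map {γ δ : Type*} (u : α → γ) (v : β → δ) (m : Multiset (α ⊕ β)) :
    right (m.map (Sum.map u v)) = (right m).map v := by
  rw [← join_left_right m, ← join_map, right_join, right_join]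

end SumMultiset

/-- Isomorphism classes of finite `G`-sets: a commutative semiring under disjoint union and
cartesian product. -/
def FinGSetClass (G : Type u) [Group G] : Type (u + 1) := Quotient (FinGSet.setoid (G := G))

namespace FinGSetClass

variable {G : Type u} [Group G]

/-- The isomorphism class of a finite `G`-set. -/
def mk (A : FinGSet G) : FinGSetClass G := Quotient.mk _ A

theorem mk_eq {A B : FinGSet G} (h : FinGSet.Iso A B) : mk A = mk B := Quotient.sound h

/-- The class of the `n`-th symmetric power. -/
def sym (n : ℕ) : FinGSetClass G → FinGSetClass G :=
  Quotient.map (FinGSet.sym n) fun _ _ => FinGSet.Iso.sym n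

instance : Zero (FinGSetClass G) := ⟨mk FinGSet.empty⟩
instance : One (FinGSetClass G) := ⟨mk FinGSet.point⟩
instance : Add (FinGSetClass G) :=
  ⟨Quotient.map₂ FinGSet.sum fun _ _ h _ _ h' => FinGSet.Iso.sum h h'⟩
instance : Mul (FinGSetClass G) :=
  ⟨Quotient.map₂ FinGSet.prod fun _ _ h _ _ h' => FinGSet.Iso.prod h h'⟩

theorem mk_add (A B : FinGSet G) : mk A + mk B = mk (FinGSet.sum A B) := rfl
theorem mk_mul (A B : FinGSet G) : mk A * mk B = mk (FinGSet.prod A B) := rfl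

protected theorem add_comm' (a b : FinGSetClass G) : a + b = b + a := by
  induction a using Quotient.ind
  induction b using Quotient.ind
  refine mk_eq ⟨Equiv.sumComm _ _, ?_⟩
  rintro g (a | b) <;> rfl

protected theorem zero_add' (a : FinGSetClass G) : 0 + a = a := by
  induction a using Quotient.ind
  refine mk_eq ⟨Equiv.emptySum PEmpty _, ?_⟩
  rintro g (a | a)
  · exact a.elim
  · rfl

protected theorem mul_comm' (a b : FinGSetClass G) : a * b = b * a := by
  induction a using Quotient.ind
  induction b using Quotient.ind
  exact mk_eq ⟨Equiv.prodComm _ _, fun _ _ => rfl⟩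

protected theorem one_mul' (a : FinGSetClass G) : 1 * a = a := by
  induction a using Quotient.ind
  exact mk_eq ⟨Equiv.punitProd _, fun _ _ => rfl⟩

protected theorem zero_mul' (a : FinGSetClass G) : 0 * a = 0 := by
  induction a using Quotient.ind
  refine mk_eq ⟨Equiv.pemptyProd _, ?_⟩
  rintro g ⟨a, _⟩
  exact a.elim

protected theorem add_mul' (a b c : FinGSetClass G) : (a + b) * c = a * c + b * c := by
  induction a using Quotient.ind
  induction b using Quotient.ind
  induction c using Quotient.ind
  refine mk_eq ⟨Equiv.sumProdDistrib _ _ _, ?_⟩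
  rintro g ⟨a | b, c⟩ <;> rfl

instance : CommSemiring (FinGSetClass G) where
  add_assoc a b c := by
    induction a using Quotient.ind
    induction b using Quotient.ind
    induction c using Quotient.ind
    refine mk_eq ⟨Equiv.sumAssoc _ _ _, ?_⟩
    rintro g ((a | b) | c) <;> rfl
  zero_add := FinGSetClass.zero_add'
  add_zero a := by rw [FinGSetClass.add_comm', FinGSetClass.zero_add']
  add_comm := FinGSetClass.add_comm'
  left_distrib a b c := by
    rw [FinGSetClass.mul_comm', FinGSetClass.add_mul', FinGSetClass.mul_comm' b,
      FinGSetClass.mul_comm' c]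
  right_distrib := FinGSetClass.add_mul'
  zero_mul := FinGSetClass.zero_mul'
  mul_zero a := by rw [FinGSetClass.mul_comm', FinGSetClass.zero_mul']
  mul_assoc a b c := by
    induction a using Quotient.ind
    induction b using Quotient.ind
    induction c using Quotient.ind
    exact mk_eq ⟨Equiv.prodAssoc _ _ _, fun _ _ => rfl⟩
  one_mul := FinGSetClass.one_mul'
  mul_one a := by rw [FinGSetClass.mul_comm', FinGSetClass.one_mul']
  mul_comm := FinGSetClass.mul_comm'
  nsmul := nsmulRec
  npow := npowRec

/-- A finite `G`-set is the disjoint union of the fibres of an invariant map. -/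
theorem mk_sub_mem {ι : Type*} (T : FinGSet G) (f : T.carrier → ι)
    (hf : ∀ (g : G) x, f (g • x) = f x) (s : Finset ι) :
    mk (T.sub (fun x => f x ∈ s) fun g x h => (hf g x).symm ▸ h) =
      ∑ i ∈ s, mk (T.sub (fun x => f x = i) fun g x h => (hf g x).trans h) := by
  classical
  induction s using Finset.induction_on with
  | empty =>
    rw [Finset.sum_empty]
    refine mk_eq ⟨⟨fun x => absurd x.2 (Finset.notMem_empty _), fun x => x.elim,
      fun x => absurd x.2 (Finset.notMem_empty _), fun x => x.elim⟩,
      fun g x => absurd x.2 (Finset.notMem_empty _)⟩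
  | insert a s ha ih =>
    rw [Finset.sum_insert ha, ← ih, mk_add]
    symm
    let F : {x // f x = a} ⊕ {x // f x ∈ s} → {x // f x ∈ insert a s} :=
      Sum.elim (fun x => ⟨x.1, by rw [x.2]; exact Finset.mem_insert_self _ _⟩)
        (fun x => ⟨x.1, Finset.mem_insert_of_mem x.2⟩)
    have hF : Function.Bijective F := by
      constructor
      · rintro (⟨x, hx⟩ | ⟨x, hx⟩) (⟨y, hy⟩ | ⟨y, hy⟩) h
        · have : x = y := congrArg Subtype.val h
          subst this; rfl
        · have : x = y := congrArg Subtype.val h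
          subst this; exact absurd (hx ▸ hy) ha
        · have : x = y := congrArg Subtype.val h
          subst this; exact absurd (hy ▸ hx) ha
        · have : x = y := congrArg Subtype.val h
          subst this; rfl
      · rintro ⟨x, hx⟩
        rcases Finset.mem_insert.1 hx with h | h
        · exact ⟨Sum.inl ⟨x, h⟩, rfl⟩
        · exact ⟨Sum.inr ⟨x, h⟩, rfl⟩
    refine mk_eq ⟨Equiv.ofBijective F hF, ?_⟩
    rintro g (x | x) <;> rfl

/-- `S^n (A ⊔ B) = ⊔_{i + j = n} S^i A × S^j B`. -/
theorem sym_add (n : ℕ) (a b : FinGSetClass G) :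
    sym n (a + b) =
      ∑ p ∈ Finset.HasAntidiagonal.antidiagonal n, sym p.1 a * sym p.2 b := by
  induction a using Quotient.ind with | _ A
  induction b using Quotient.ind with | _ B
  let T := FinGSet.sym n (A.sum B)
  let L : T.carrier → Multiset A.carrier := fun x => SumMultiset.left x.1
  let R : T.carrier → Multiset B.carrier := fun x => SumMultiset.right x.1
  have hT : ∀ x : T.carrier, SumMultiset.join (L x) (R x) = x.1 := fun x =>
    SumMultiset.join_left_right _
  have hLg : ∀ (g : G) (x : T.carrier), L (g • x) = (L x).map (g • ·) := fun g x =>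
    SumMultiset.left_map _ _ _
  have hRg : ∀ (g : G) (x : T.carrier), R (g • x) = (R x).map (g • ·) := fun g x =>
    SumMultiset.right_map _ _ _
  let f : T.carrier → ℕ × ℕ := fun x => (Multiset.card (L x), Multiset.card (R x))
  have hf : ∀ (g : G) x, f (g • x) = f x := by
    intro g x
    simp only [f, hLg, hRg, Multiset.card_map]
  have hmem : ∀ x : T.carrier, f x ∈ Finset.HasAntidiagonal.antidiagonal n := by
    intro x
    rw [Finset.HasAntidiagonal.mem_antidiagonal]
    exact (SumMultiset.card_join (L x) (R x)).symm.trans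
      ((congrArg Multiset.card (hT x)).trans x.2)
  have h0 : sym n (mk A + mk B) = mk (T.sub
      (fun x => f x ∈ Finset.HasAntidiagonal.antidiagonal n)
      fun g x h => (hf g x).symm ▸ h) :=
    (mk_eq ⟨Equiv.subtypeUnivEquiv hmem, fun _ _ => rfl⟩ :
      mk (T.sub (fun x => f x ∈ Finset.HasAntidiagonal.antidiagonal n) _) = mk T).symm
  refine h0.trans ?_
  rw [mk_sub_mem T f hf]
  refine Finset.sum_congr rfl ?_
  rintro ⟨i, j⟩ hij
  rw [Finset.HasAntidiagonal.mem_antidiagonal] at hij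
  symm
  let J : Sym A.carrier i × Sym B.carrier j → T.carrier := fun q =>
    ⟨SumMultiset.join q.1.1 q.2.1,
      (SumMultiset.card_join q.1.1 q.2.1).trans (by rw [q.1.2, q.2.2]; exact hij)⟩
  have hLJ : ∀ q, L (J q) = q.1.1 := fun q => SumMultiset.left_join _ _
  have hRJ : ∀ q, R (J q) = q.2.1 := fun q => SumMultiset.right_join _ _
  let F : Sym A.carrier i × Sym B.carrier j → {x : T.carrier // f x = (i, j)} := fun q =>
    ⟨J q, Prod.ext ((congrArg Multiset.card (hLJ q)).trans q.1.2)
      ((congrArg Multiset.card (hRJ q)).trans q.2.2)⟩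
  have hF : Function.Bijective F := by
    constructor
    · intro q q' h
      have h' : J q = J q' := congrArg Subtype.val h
      refine Prod.ext (Subtype.ext ?_) (Subtype.ext ?_)
      · rw [← hLJ q, h', hLJ]
      · rw [← hRJ q, h', hRJ]
    · rintro ⟨x, hx⟩
      exact ⟨(⟨L x, congrArg Prod.fst hx⟩, ⟨R x, congrArg Prod.snd hx⟩),
        Subtype.ext (Subtype.ext (hT x))⟩
  refine mk_eq ⟨Equiv.ofBijective F hF, fun g q => ?_⟩
  exact Subtype.ext (Subtype.ext (SumMultiset.join_map (g • ·) (g • ·) q.1.1 q.2.1))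

theorem sym_zero (a : FinGSetClass G) : sym 0 a = 1 := by
  induction a using Quotient.ind with | _ A
  refine mk_eq ⟨⟨fun _ => PUnit.unit, fun _ => (Sym.nil : Sym A.carrier 0), fun x => ?_,
    fun _ => rfl⟩, fun _ _ => rfl⟩
  exact (Subsingleton.elim (α := Sym A.carrier 0) _ _)

end FinGSetClass

/-- The Burnside ring `K_0(f.G-s.)`: the Grothendieck ring (group completion) of the semiring
of isomorphism classes of finite `G`-sets. -/
def BurnsideRing (G : Type u) [Group G] : Type (u + 1) := ℤ ⊗[ℕ] FinGSetClass G

instance (G : Type u) [Group G] : CommRing (BurnsideRing G) :=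
  inferInstanceAs (CommRing (ℤ ⊗[ℕ] FinGSetClass G))


namespace BurnsideRing

open PowerSeries

variable {G : Type u} [Group G]

/-- The class of a finite `G`-set in the Burnside ring. -/
def of : FinGSetClass G →+* BurnsideRing G :=
  (Algebra.TensorProduct.includeRight : FinGSetClass G →ₐ[ℕ] ℤ ⊗[ℕ] FinGSetClass G).toRingHom

/-- The class `[G/H]`. -/
def coset [Finite G] (H : Subgroup G) : BurnsideRing G :=
  of (FinGSetClass.mk (FinGSet.coset H))

/-- The series `σ_A(t) = 1 + [A] t + [S^2 A] t^2 + ⋯` of a finite `G`-set `A`. -/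
def symSeries (a : FinGSetClass G) : PowerSeries (BurnsideRing G) :=
  PowerSeries.mk fun n => of (FinGSetClass.sym n a)

theorem symSeries_add (a b : FinGSetClass G) :
    symSeries (a + b) = symSeries a * symSeries b := by
  ext n
  rw [PowerSeries.coeff_mul, symSeries, PowerSeries.coeff_mk, FinGSetClass.sym_add, map_sum]
  simp [symSeries]

/-- `σ_A(t)` as an invertible power series. -/
def symUnit (a : FinGSetClass G) : (PowerSeries (BurnsideRing G))ˣ :=
  have h : symSeries a * invOfUnit (symSeries a) 1 = 1 :=
    mul_invOfUnit _ _ (by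
      rw [← coeff_zero_eq_constantCoeff_apply, symSeries, PowerSeries.coeff_mk,
        FinGSetClass.sym_zero, map_one, Units.val_one])
  ⟨symSeries a, invOfUnit (symSeries a) 1, h, (mul_comm _ _).trans h⟩

/-- `A ↦ σ_A(t)`, a homomorphism from the additive monoid of classes of finite `G`-sets to the
multiplicative group of invertible power series. -/
def symUnitHom : FinGSetClass G →+ Additive (PowerSeries (BurnsideRing G))ˣ :=
  AddMonoidHom.mk' (fun a => Additive.ofMul (symUnit a)) fun a b =>
    congrArg Additive.ofMul (Units.ext (symSeries_add a b))

/-- The extension of `A ↦ σ_A(t)` to the Burnside ring: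
`σ_{[A] - [B]}(t) = σ_A(t) / σ_B(t)`. -/
def sigmaHom : BurnsideRing G →+ Additive (PowerSeries (BurnsideRing G))ˣ :=
  TensorProduct.liftAddHom
    (zmultiplesHom (FinGSetClass G →+ Additive (PowerSeries (BurnsideRing G))ˣ) symUnitHom)
    fun r m n => by
      rw [map_nsmul, AddMonoidHom.nsmul_apply, map_nsmul]

/-- The pre-`λ`-structure `a ↦ σ_a(t) = (1 - t)^{-a}` on the Burnside ring. -/
def sigma (a : BurnsideRing G) : PowerSeries (BurnsideRing G) :=
  ((sigmaHom a).toMul : (PowerSeries (BurnsideRing G))ˣ)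

theorem of_apply (a : FinGSetClass G) : of a = (1 : ℤ) ⊗ₜ[ℕ] a := rfl

theorem sigmaHom_of (a : FinGSetClass G) : sigmaHom (of a) = Additive.ofMul (symUnit a) := by
  rw [of_apply]
  refine (TensorProduct.liftAddHom_tmul _ _ (1 : ℤ) a).trans ?_
  rw [zmultiplesHom_apply, one_zsmul]
  rfl

theorem sigma_of (a : FinGSetClass G) : sigma (of a) = symSeries a := by
  rw [sigma, sigmaHom_of]
  rfl

end BurnsideRing

/-! ## Infinite products and power structures -/

section PowerStructure

open PowerSeries

variable {R : Type*} [CommRing R]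

/-- The infinite product `∏_{i ≥ 0} F i` of series with `F i ≡ 1 mod t^{i+1}`: its coefficient
at `t^n` is that of the finite product over `i < n`. -/
def seriesProd (F : ℕ → PowerSeries R) : PowerSeries R :=
  PowerSeries.mk fun n => coeff n (∏ i ∈ Finset.range n, F i)

/-- The unique sequence `b` with `A(t) = ∏_{i ≥ 0} σ_{b_i}(t^{i+1})`, where
`σ_b(t) = 1 + b t + ⋯` is a pre-`λ`-structure and `A(t) ∈ 1 + t R[[t]]`. -/
def eulerExponent (σ : R → PowerSeries R) (A : PowerSeries R) (n : ℕ) : R :=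
  coeff (n + 1) A -
    coeff (n + 1) (∏ i : Fin n, expand (i.1 + 1) i.1.succ_ne_zero (σ (eulerExponent σ A i.1)))
termination_by n
decreasing_by exact i.2

/-- The power structure induced by a pre-`λ`-structure `σ`: if
`A(t) = ∏_{i ≥ 1} (1 - t^i)^{-b_i} := ∏_{i ≥ 1} σ_{b_i}(t^i)`, then
`A(t)^a = ∏_{i ≥ 1} (1 - t^i)^{-a b_i} := ∏_{i ≥ 1} σ_{a b_i}(t^i)`. -/
def powerStructure (σ : R → PowerSeries R) (A : PowerSeries R) (a : R) : PowerSeries R :=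
  seriesProd fun i => expand (i + 1) i.succ_ne_zero (σ (a * eulerExponent σ A i))

end PowerStructure

/-- The power `A(t)^a` of `A(t) ∈ 1 + t K_0(f.G-s.)[[t]]` with exponent `a ∈ K_0(f.G-s.)`. -/
def BurnsideRing.pow {G : Type u} [Group G] (A : PowerSeries (BurnsideRing G))
    (a : BurnsideRing G) : PowerSeries (BurnsideRing G) :=
  powerStructure BurnsideRing.sigma A a

/-! ## Cohomology of pairs and Lefschetz numbers -/

/-- The two usual choices of supports for cohomology: closed supports (ordinary cohomology) and
compact supports. -/
inductive Supports
  | closed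
  | compact

section Cohomology

variable {Y : Type v} [TopologicalSpace Y]

/-- Membership of a subset in the chosen family of supports. -/
def Supports.Mem (Φ : Supports) (K : Set Y) : Prop :=
  match Φ with
  | .closed => IsClosed K
  | .compact => IsCompact K

theorem Supports.Mem.empty (Φ : Supports) : Φ.Mem (∅ : Set Y) := by
  cases Φ
  · exact isClosed_empty
  · exact isCompact_empty

theorem Supports.Mem.union {Φ : Supports} {K L : Set Y} (hK : Φ.Mem K) (hL : Φ.Mem L) :
    Φ.Mem (K ∪ L) := by
  cases Φ
  · exact IsClosed.union hK hL
  · exact IsCompact.union hK hL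

/-- Singular `n`-simplices of the subspace `Z` of `Y`. -/
abbrev Simplex (Z : Set Y) (n : ℕ) : Type v :=
  {s : C(stdSimplex ℝ (Fin (n + 1)), Y) // ∀ p, s p ∈ Z}

/-- The `i`-th face of a singular simplex. -/
def Simplex.face {Z : Set Y} {n : ℕ} (i : Fin (n + 2)) (s : Simplex Z (n + 1)) : Simplex Z n :=
  ⟨s.1.comp ⟨stdSimplex.map i.succAbove, stdSimplex.continuous_map _⟩, fun _ => s.2 _⟩

/-- Integral singular cochains of `Z`. -/
abbrev Cochain (Z : Set Y) (n : ℕ) : Type v := Simplex Z n → ℤ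

/-- The singular coboundary operator. -/
def coboundary (Z : Set Y) (n : ℕ) : Cochain Z n →ₗ[ℤ] Cochain Z (n + 1) where
  toFun c s := ∑ i : Fin (n + 2), (-1) ^ (i : ℕ) * c (s.face i)
  map_add' c d := by
    funext s
    simp [mul_add, Finset.sum_add_distrib]
  map_smul' r c := by
    funext s
    simp [Finset.mul_sum, mul_left_comm]

/-- Cochains of `Z` which vanish on the simplices of `A`, and whose support is contained in a
member `K` of the family `Φ`, that is, which vanish on the simplices that do not meet `K`.
For compact supports and `Z` closed in `Y`, one gets the same cochains by taking only `K ⊆ Z`. -/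
def relCochain (Φ : Supports) (Z A : Set Y) (n : ℕ) : Submodule ℤ (Cochain Z n) where
  carrier := {c | (∀ s : Simplex Z n, (∀ p, s.1 p ∈ A) → c s = 0) ∧
    ∃ K, Φ.Mem K ∧ ∀ s : Simplex Z n, (∀ p, s.1 p ∉ K) → c s = 0}
  zero_mem' := ⟨fun _ _ => rfl, ∅, Supports.Mem.empty Φ, fun _ _ => rfl⟩
  add_mem' := by
    rintro c d ⟨hc, K, hK, hcK⟩ ⟨hd, L, hL, hdL⟩
    refine ⟨fun s hs => ?_, K ∪ L, hK.union hL, fun s hs => ?_⟩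
    · simp [hc s hs, hd s hs]
    · have h1 := hcK s fun p hp => hs p (Or.inl hp)
      have h2 := hdL s fun p hp => hs p (Or.inr hp)
      simp [h1, h2]
  smul_mem' := by
    rintro r c ⟨hc, K, hK, hcK⟩
    refine ⟨fun s hs => ?_, K, hK, fun s hs => ?_⟩
    · simp [hc s hs]
    · simp [hcK s hs]

/-- Relative cocycles. -/
def cocycle (Φ : Supports) (Z A : Set Y) (n : ℕ) : Submodule ℤ (Cochain Z n) :=
  relCochain Φ Z A n ⊓ LinearMap.ker (coboundary Z n)

/-- Coboundaries of relative cochains. -/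
def coboundaries (Φ : Supports) (Z A : Set Y) : (n : ℕ) → Submodule ℤ (Cochain Z n)
  | 0 => ⊥
  | n + 1 => (relCochain Φ Z A n).map (coboundary Z n)

/-- The relative integral singular cohomology `H^n_Φ(Z, A; ℤ)`. -/
abbrev RelCohomology (Φ : Supports) (Z A : Set Y) (n : ℕ) : Type v :=
  cocycle Φ Z A n ⧸ (coboundaries Φ Z A n).comap (cocycle Φ Z A n).subtype

/-- The graded group `H^*_Φ(Z, A; ℤ)` is finitely generated. -/
def FiniteCohomology (Φ : Supports) (Z A : Set Y) : Prop :=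
  (∀ n, Module.Finite ℤ (RelCohomology Φ Z A n)) ∧
    ∃ N, ∀ n ≥ N, Subsingleton (RelCohomology Φ Z A n)

/-- `f` is a continuous map of `Y` which preserves `Z` and `A` and, in the case of compact
supports, has compact preimages of compact sets: such an `f` acts on `H^*_Φ(Z, A)`. -/
structure IsPairMap (Φ : Supports) (Z A : Set Y) (f : Y → Y) : Prop where
  continuous : Continuous f
  mapsTo : Set.MapsTo f Z Z
  mapsTo_sub : Set.MapsTo f A A
  proper : Φ = .compact → ∀ K : Set Y, IsCompact K → IsCompact (f ⁻¹' K)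

theorem IsPairMap.mem_preimage {Φ : Supports} {Z A : Set Y} {f : Y → Y}
    (hf : IsPairMap Φ Z A f) {K : Set Y} (hK : Φ.Mem K) : Φ.Mem (f ⁻¹' K) := by
  cases Φ
  · exact IsClosed.preimage hf.continuous hK
  · exact hf.proper rfl K hK

theorem IsPairMap.iterate {Φ : Supports} {Z A : Set Y} {f : Y → Y} (hf : IsPairMap Φ Z A f)
    (m : ℕ) : IsPairMap Φ Z A f^[m] where
  continuous := hf.continuous.iterate m
  mapsTo := hf.mapsTo.iterate m
  mapsTo_sub := hf.mapsTo_sub.iterate m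
  proper hΦ := by
    induction m with
    | zero => exact fun K hK => hK
    | succ m ih => exact fun K hK => hf.proper hΦ _ (ih K hK)

/-- The composition of a singular simplex with a map. -/
def Simplex.push {Z : Set Y} {n : ℕ} (f : Y → Y) (hc : Continuous f) (hZ : Set.MapsTo f Z Z)
    (s : Simplex Z n) : Simplex Z n :=
  ⟨(⟨f, hc⟩ : C(Y, Y)).comp s.1, fun p => hZ (s.2 p)⟩

/-- The pull-back of cochains. -/
def pullback {Z : Set Y} (n : ℕ) (f : Y → Y) (hc : Continuous f) (hZ : Set.MapsTo f Z Z) :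
    Cochain Z n →ₗ[ℤ] Cochain Z n :=
  LinearMap.funLeft ℤ ℤ (Simplex.push f hc hZ)

theorem pullback_coboundary {Z : Set Y} (n : ℕ) (f : Y → Y) (hc : Continuous f)
    (hZ : Set.MapsTo f Z Z) (c : Cochain Z n) :
    pullback (n + 1) f hc hZ (coboundary Z n c) = coboundary Z n (pullback n f hc hZ c) := rfl

theorem pullback_mem_relCochain {Φ : Supports} {Z A : Set Y} {f : Y → Y}
    (hf : IsPairMap Φ Z A f) (n : ℕ) {c : Cochain Z n} (h : c ∈ relCochain Φ Z A n) :
    pullback n f hf.continuous hf.mapsTo c ∈ relCochain Φ Z A n := by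
  obtain ⟨hA, K, hK, hcK⟩ := h
  exact ⟨fun s hs => hA _ fun p => hf.mapsTo_sub (hs p), f ⁻¹' K, hf.mem_preimage hK,
    fun s hs => hcK _ fun p => hs p⟩

/-- The action of a map of pairs on relative cocycles. -/
def cocycleMap {Φ : Supports} {Z A : Set Y} {f : Y → Y} (hf : IsPairMap Φ Z A f) (n : ℕ) :
    cocycle Φ Z A n →ₗ[ℤ] cocycle Φ Z A n :=
  (pullback n f hf.continuous hf.mapsTo).restrict fun c hc =>
    ⟨pullback_mem_relCochain hf n hc.1, by
      have h : coboundary Z n c = 0 := hc.2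
      change coboundary Z n (pullback n f hf.continuous hf.mapsTo c) = 0
      rw [← pullback_coboundary, h, map_zero]⟩

/-- The action `f^*` of a map of pairs on `H^n_Φ(Z, A; ℤ)`. -/
def cohomologyMap {Φ : Supports} {Z A : Set Y} {f : Y → Y} (hf : IsPairMap Φ Z A f) (n : ℕ) :
    RelCohomology Φ Z A n →ₗ[ℤ] RelCohomology Φ Z A n :=
  Submodule.mapQ _ _ (cocycleMap hf n) (by
    rintro ⟨c, hc⟩ h
    cases n with
    | zero =>
      have h0 : c = 0 := h
      subst h0
      exact map_zero (pullback 0 f hf.continuous hf.mapsTo)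
    | succ n =>
      obtain ⟨d, hd, hdc⟩ := h
      exact ⟨pullback n f hf.continuous hf.mapsTo d, pullback_mem_relCochain hf n hd,
        (pullback_coboundary n f hf.continuous hf.mapsTo d).symm.trans
          (congrArg (pullback (n + 1) f hf.continuous hf.mapsTo) hdc)⟩)

/-- The action of `f` on `H^n_Φ(Z, A; ℤ)` modulo torsion. -/
def freeCohomologyMap {Φ : Supports} {Z A : Set Y} {f : Y → Y} (hf : IsPairMap Φ Z A f)
    (n : ℕ) :
    (RelCohomology Φ Z A n ⧸ Submodule.torsion ℤ (RelCohomology Φ Z A n)) →ₗ[ℤ]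
      (RelCohomology Φ Z A n ⧸ Submodule.torsion ℤ (RelCohomology Φ Z A n)) :=
  Submodule.mapQ _ _ (cohomologyMap hf n) (by
    rintro x ⟨a, ha⟩
    refine ⟨a, ?_⟩
    have ha' : (a : ℤ) • x = 0 := ha
    change (a : ℤ) • cohomologyMap hf n x = 0
    rw [← map_smul, ha', map_zero])

/-- The Lefschetz number `L(f|_{(Z, A)}) = ∑_n (-1)^n tr(f^* : H^n_Φ(Z, A) → H^n_Φ(Z, A))`. The
traces are those on the cohomology modulo torsion, i.e. on rational cohomology. -/
def lefschetz {Φ : Supports} {Z A : Set Y} {f : Y → Y} (hf : IsPairMap Φ Z A f) : ℤ :=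
  ∑ᶠ n : ℕ, (-1) ^ n * LinearMap.trace ℤ _ (freeCohomologyMap hf n)

end Cohomology

/-! ## Zeta functions -/

/-- The elements `s_m` defined recursively by `L_m = ∑_{i ∣ m} s_i` for `m ≥ 1`. -/
def primitivePart {M : Type*} [AddCommGroup M] (L : ℕ → M) (m : ℕ) : M :=
  L m - ∑ i : m.properDivisors, primitivePart L i.1
termination_by m
decreasing_by exact (Nat.mem_properDivisors.1 i.2).2

theorem sum_primitivePart {M : Type*} [AddCommGroup M] (L : ℕ → M) {m : ℕ} (hm : m ≠ 0) :
    ∑ i ∈ m.divisors, primitivePart L i = L m := by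
  rw [← Nat.cons_self_properDivisors hm, Finset.sum_cons, primitivePart,
    Finset.sum_coe_sort m.properDivisors (primitivePart L)]
  abel

/-- The quotient `s / m`: the element `q` with `m • q = s` (which is unique when `M` is
torsion-free and `m ≥ 1`), if there is one. -/
def natQuotient {M : Type*} [AddCommGroup M] (m : ℕ) (s : M) : M :=
  open Classical in if h : ∃ q : M, m • q = s then h.choose else 0

/-- `1 - t^{i+1}` as an invertible power series. -/
def oneSubPow (i : ℕ) : (PowerSeries ℤ)ˣ :=
  have h : (1 - PowerSeries.X ^ (i + 1)) *
      PowerSeries.invOfUnit (1 - PowerSeries.X ^ (i + 1) : PowerSeries ℤ) 1 = 1 :=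
    PowerSeries.mul_invOfUnit _ _ (by simp)
  ⟨1 - PowerSeries.X ^ (i + 1), PowerSeries.invOfUnit (1 - PowerSeries.X ^ (i + 1)) 1, h,
    (mul_comm _ _).trans h⟩

section Zeta

variable {Y : Type v} [TopologicalSpace Y]

/-- The integers `s_m(f)`, with `L(f^m) = ∑_{i ∣ m} s_i(f)`. -/
def primitiveLefschetz {Φ : Supports} {f : Y → Y} (hf : IsPairMap Φ Set.univ ∅ f) : ℕ → ℤ :=
  primitivePart fun m => lefschetz (hf.iterate m)

/-- The zeta function `ζ_f(t) = ∏_{m ≥ 1} (1 - t^m)^{- s_m(f) / m}` of a transformation. -/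
def zeta {Φ : Supports} {f : Y → Y} (hf : IsPairMap Φ Set.univ ∅ f) : PowerSeries ℤ :=
  seriesProd fun i =>
    ((oneSubPow i ^ (-natQuotient (i + 1) (primitiveLefschetz hf (i + 1))) :
      (PowerSeries ℤ)ˣ) : PowerSeries ℤ)

end Zeta

/-! ## Equivariant maps -/

section ConjugacyClasses

variable (G : Type u) [Group G]

/-- Conjugacy of subgroups. -/
def subgroupConj : Setoid (Subgroup G) where
  r H K := ∃ g : G, H.map (MulAut.conj g).toMonoidHom = K
  iseqv :=
    { refl := fun H => ⟨1, by ext; simp⟩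
      symm := by
        rintro H K ⟨g, rfl⟩
        refine ⟨g⁻¹, ?_⟩
        ext x
        simp [Subgroup.mem_map, mul_assoc]
      trans := by
        rintro H K L ⟨g, rfl⟩ ⟨h, rfl⟩
        refine ⟨h * g, ?_⟩
        ext x
        simp [Subgroup.mem_map, mul_assoc] }

/-- The set of conjugacy classes of subgroups of `G`. -/
def ConSub : Type u := Quotient (subgroupConj G)

variable {G}

/-- The conjugacy class of a subgroup. -/
def ConSub.mk (H : Subgroup G) : ConSub G := Quotient.mk (subgroupConj G) H

/-- A representative of a conjugacy class. -/
def ConSub.rep (c : ConSub G) : Subgroup G := Quotient.out c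

/-- The strict order on conjugacy classes: some representatives are strictly included. -/
def ConSub.Lt (c d : ConSub G) : Prop :=
  ∃ H K : Subgroup G, ConSub.mk H = c ∧ ConSub.mk K = d ∧ H < K

end ConjugacyClasses

section Equivariant

variable (G : Type u) [Group G] (X : Type v) [MulAction G X]

/-- The set `X^𝔥` of points fixed by some subgroup in the class `𝔥`. -/
def fixedSet {G : Type u} [Group G] (X : Type v) [MulAction G X] (c : ConSub G) : Set X :=
  {x | ∃ H : Subgroup G, ConSub.mk H = c ∧ ∀ g ∈ H, g • x = x}

/-- The set `X^{>𝔥}`, the union of `X^𝔥'` over the classes `𝔥' > 𝔥`. -/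
def fixedSetAbove {G : Type u} [Group G] (X : Type v) [MulAction G X] (c : ConSub G) : Set X :=
  {x | ∃ d : ConSub G, c.Lt d ∧ x ∈ fixedSet X d}

/-- The orbit space `X/G`. -/
abbrev OrbitSpace : Type v := MulAction.orbitRel.Quotient G X

variable {X}

/-- The projection `X → X/G`. -/
def toOrbit (x : X) : OrbitSpace G X := Quotient.mk (MulAction.orbitRel G X) x

variable [TopologicalSpace X]

/-- `φ` is a continuous `G`-equivariant map `X → X` which, in the case of compact supports, has
compact preimages of compact sets. -/
structure IsGMap (Φ : Supports) (φ : X → X) : Prop where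
  continuous : Continuous φ
  equivariant : ∀ (g : G) (x : X), φ (g • x) = g • φ x
  proper : Φ = .compact → ∀ K : Set X, IsCompact K → IsCompact (φ ⁻¹' K)

namespace IsGMap

variable {G} {Φ : Supports} {φ : X → X}

theorem iterate (hφ : IsGMap G Φ φ) (m : ℕ) : IsGMap G Φ φ^[m] where
  continuous := hφ.continuous.iterate m
  equivariant g := by
    induction m with
    | zero => exact fun x => rfl
    | succ m ih =>
      intro x
      rw [Function.iterate_succ_apply, Function.iterate_succ_apply, hφ.equivariant, ih]
  proper hΦ := by
    induction m with
    | zero => exact fun K hK => hK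
    | succ m ih => exact fun K hK => hφ.proper hΦ _ (ih K hK)

/-- The map `X/G → X/G` induced by an equivariant map. -/
def orbitMap (hφ : IsGMap G Φ φ) : OrbitSpace G X → OrbitSpace G X :=
  Quotient.map φ (by
    rintro _ y ⟨g, rfl⟩
    exact ⟨g, (hφ.equivariant g y).symm⟩)

theorem continuous_orbitMap (hφ : IsGMap G Φ φ) : Continuous hφ.orbitMap :=
  hφ.continuous.quotient_map' _

theorem isCompact_toOrbit_preimage [Finite G] [ContinuousConstSMul G X]
    {K : Set (OrbitSpace G X)} (hK : IsCompact K) : IsCompact (toOrbit G ⁻¹' K : Set X) := by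
  let _ : TopologicalSpace G := ⊥
  have : DiscreteTopology G := ⟨rfl⟩
  have : ContinuousSMul G X := ⟨continuous_prod_of_discrete_left.2 fun g => continuous_const_smul g⟩
  have hp : IsProperMap (toOrbit G : X → OrbitSpace G X) := by
    rw [isProperMap_iff_isClosedMap_and_compact_fibers]
    refine ⟨continuous_quotient_mk', MulAction.isClosedMap_quotient, fun y => ?_⟩
    obtain ⟨x, rfl⟩ := Quotient.exists_rep y
    refine Set.Finite.isCompact ((Set.finite_range fun g : G => g • x).subset ?_)
    intro z hz
    exact Quotient.exact hz
  exact hp.isCompact_preimage hK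

theorem isPairMap [Finite G] [ContinuousConstSMul G X] (hφ : IsGMap G Φ φ)
    {Z A : Set X} (hZ : Set.MapsTo φ Z Z) (hA : Set.MapsTo φ A A) :
    IsPairMap Φ (toOrbit G '' Z) (toOrbit G '' A) hφ.orbitMap where
  continuous := hφ.continuous_orbitMap
  mapsTo := by
    rintro _ ⟨x, hx, rfl⟩
    exact ⟨φ x, hZ hx, rfl⟩
  mapsTo_sub := by
    rintro _ ⟨x, hx, rfl⟩
    exact ⟨φ x, hA hx, rfl⟩
  proper hΦ K hK := by
    have h : hφ.orbitMap ⁻¹' K = toOrbit G '' (φ ⁻¹' (toOrbit G ⁻¹' K)) := by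
      ext y
      constructor
      · intro hy
        obtain ⟨x, rfl⟩ := Quotient.exists_rep y
        exact ⟨x, hy, rfl⟩
      · rintro ⟨x, hx, rfl⟩
        exact hx
    rw [h]
    exact (hφ.proper hΦ _ (isCompact_toOrbit_preimage hK)).image continuous_quotient_mk'

theorem mapsTo_fixedSet (hφ : IsGMap G Φ φ) (c : ConSub G) :
    Set.MapsTo φ (fixedSet X c) (fixedSet X c) := by
  rintro x ⟨H, hH, hx⟩
  exact ⟨H, hH, fun g hg => by rw [← hφ.equivariant, hx g hg]⟩

theorem mapsTo_fixedSetAbove (hφ : IsGMap G Φ φ) (c : ConSub G) :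
    Set.MapsTo φ (fixedSetAbove X c) (fixedSetAbove X c) := by
  rintro x ⟨d, hd, hx⟩
  exact ⟨d, hd, hφ.mapsTo_fixedSet d hx⟩

variable [Finite G] [ContinuousConstSMul G X]

theorem isPairMap_orbitSpace (hφ : IsGMap G Φ φ) :
    IsPairMap Φ (Set.univ : Set (OrbitSpace G X)) ∅ hφ.orbitMap where
  continuous := hφ.continuous_orbitMap
  mapsTo := Set.mapsTo_univ _ _
  mapsTo_sub := Set.mapsTo_empty _ _
  proper := (hφ.isPairMap (Set.mapsTo_univ φ _) (Set.mapsTo_univ φ Set.univ)).proper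

/-- The equivariant Lefschetz number counting fixed orbits,
`∑_𝔥 L(φ|_{(X^𝔥/G, X^{>𝔥}/G)}) [G/H]`, an element of the Burnside ring. -/
def equivLefschetz (hφ : IsGMap G Φ φ) : BurnsideRing G :=
  ∑ᶠ c : ConSub G,
    lefschetz (hφ.isPairMap (hφ.mapsTo_fixedSet c) (hφ.mapsTo_fixedSetAbove c)) •
      BurnsideRing.coset c.rep

/-- The elements `s̃_m(φ)`, with `L̃(φ^m) = ∑_{i ∣ m} s̃_i(φ)`. -/
def primitiveEquivLefschetz (hφ : IsGMap G Φ φ) : ℕ → BurnsideRing G :=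
  primitivePart fun m => (hφ.iterate m).equivLefschetz

/-- The equivariant zeta function `∏_{m ≥ 1} (1 - t^m)^{- s̃_m(φ) / m}`. -/
def equivZeta (hφ : IsGMap G Φ φ) : PowerSeries (BurnsideRing G) :=
  seriesProd fun i =>
    BurnsideRing.pow (1 - PowerSeries.X ^ (i + 1))
      (-natQuotient (i + 1) (hφ.primitiveEquivLefschetz (i + 1)))

end IsGMap

end Equivariant

end

/-! The zeta functions of an equivariant map with a single orbit type.

If all isotropy subgroups are conjugate to `H`, then for the class of `H` the pair
`(X^𝔥, X^{>𝔥})` is `(X, ∅)`, while for every other class `X^{>𝔥} = X^𝔥`, so that the relative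
cohomology vanishes. Hence `L̃(φ^m) = L(φ^m on X/G) • [G/H]` and
`s̃_m = s_m • [G/H]` (`IsGMap.primitiveEquivLefschetz_eq`).

That `m` divides `s_m` is Dold's congruence (`dvd_primitivePart_lefschetz`). As `L(f^m)` is an
alternating sum of traces of `m`-th powers of integral matrices, it suffices to treat
`m ↦ tr (A^m)` (`Matrix.dvd_primitivePart_trace_pow`). By Jacobi's formula, `-∑ tr (A^n) t^n` is
the logarithmic derivative `t u'/u` of `u = det (1 - t A) ∈ 1 + t ℤ[[t]]`. Up to any order `u` is a
product of integral powers of the `1 - t^k`, whose logarithmic derivatives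
`-k (t^k + t^{2k} + ⋯)` have all primitive parts divisible by their index
(`dvd_primitivePart_coeff_xLogDeriv`).

Quotients by `m` in the Burnside ring are unique because it is torsion-free: the marks `|A^K|` are
additive, integer-valued and determine a finite `G`-set (`FinGSet.iso_of_mark_eq`).

The product formula is then formal. Since `σ_b(t) = 1 + b t + ⋯`, the exponents in
`∏ σ_{b_i}(t^i)` are determined by the product (`eulerExponent_eq_of_coeff`), and
`σ_n(t) = (1 - t)^{-n}` for integers `n` (`BurnsideRing.map_oneSubPow_zpow`). Therefore the power
`[G/H]` of `∏ (1 - t^m)^{-s_m/m}` is `∏ σ_{(s_m/m)[G/H]}(t^m)`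
(`BurnsideRing.pow_map_seriesProd_oneSubPow`), the equivariant zeta function. -/

noncomputable section

/-! ### Infinite products of power series and Euler exponents -/

section PowerStructure

open PowerSeries

variable {R : Type*} [CommRing R]

/-- If `s(t) = 1 + b t + ⋯`, then `s(t^{n+1}) ≡ 1 + b t^{n+1}` modulo `t^{n+2}`. -/
theorem X_pow_succ_dvd_expand_sub {s : PowerSeries R} {b : R} (h0 : coeff 0 s = 1)
    (h1 : coeff 1 s = b) (n : ℕ) :
    (X ^ (n + 2) : PowerSeries R) ∣
      expand (n + 1) n.succ_ne_zero s - (1 + C b * X ^ (n + 1)) := by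
  rw [X_pow_dvd_iff]
  intro m hm
  rw [map_sub, map_add, coeff_C_mul, coeff_X_pow, coeff_expand, coeff_one]
  rcases Nat.eq_zero_or_pos m with rfl | hm0
  · simp [h0]
  by_cases h : m = n + 1
  · subst h; simp [h1]
  · have : ¬ n + 1 ∣ m := fun hd => h (le_antisymm (by omega) (Nat.le_of_dvd hm0 hd))
    simp [this, h, hm0.ne']

/-- Uniqueness of the representation `A(t) = ∏ σ_{b_i}(t^i)`: in degree `n + 1` the factors beyond
the `n`-th do not contribute, and the `n`-th contributes exactly `b n`. -/
theorem eulerExponent_eq_of_coeff {σ : R → PowerSeries R} (h0 : ∀ b, coeff 0 (σ b) = 1)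
    (h1 : ∀ b, coeff 1 (σ b) = b) {A : PowerSeries R} {b : ℕ → R}
    (hA : A = seriesProd fun i => expand (i + 1) i.succ_ne_zero (σ (b i))) (n : ℕ) :
    eulerExponent σ A n = b n := by
  induction n using Nat.strong_induction_on with
  | _ n ih =>
    have hc : ∀ i, constantCoeff (expand (i + 1) i.succ_ne_zero (σ (b i))) = 1 := fun i => by
      rw [constantCoeff_expand, ← coeff_zero_eq_constantCoeff_apply, h0]
    have hP : ∏ i : Fin n, expand (i.1 + 1) i.1.succ_ne_zero (σ (eulerExponent σ A i.1)) =
        ∏ i ∈ Finset.range n, expand (i + 1) i.succ_ne_zero (σ (b i)) := by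
      rw [← Fin.prod_univ_eq_prod_range fun i => expand (i + 1) i.succ_ne_zero (σ (b i))]
      exact Finset.prod_congr rfl fun i _ => by rw [ih i.1 i.2]
    obtain ⟨w, hw⟩ := X_pow_succ_dvd_expand_sub (h0 (b n)) (h1 (b n)) n
    rw [eulerExponent, hP, hA, seriesProd, coeff_mk, Finset.prod_range_succ,
      sub_eq_iff_eq_add.1 hw]
    set P := ∏ i ∈ Finset.range n, expand (i + 1) i.succ_ne_zero (σ (b i)) with hPdef
    have hP0 : coeff 0 P = 1 := by
      rw [coeff_zero_eq_constantCoeff_apply, hPdef, map_prod]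
      exact Finset.prod_eq_one fun i _ => hc i
    have e : P * (X ^ (n + 2) * w + (1 + C (b n) * X ^ (n + 1))) =
        P + (C (b n) * P + X * (P * w)) * X ^ (n + 1) := by ring
    rw [e, map_add, add_sub_cancel_left, coeff_mul_X_pow', if_pos le_rfl, Nat.sub_self, map_add,
      coeff_C_mul, hP0, coeff_zero_X_mul, mul_one, add_zero]

/-- The infinite product with a single nontrivial factor. -/
theorem seriesProd_eq_of_single {F : ℕ → PowerSeries R} (j : ℕ) (h : ∀ i, i ≠ j → F i = 1)
    (hj : (X ^ (j + 1) : PowerSeries R) ∣ F j - 1) : seriesProd F = F j := by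
  ext n
  rw [seriesProd, coeff_mk]
  by_cases hn : j < n
  · rw [Finset.prod_eq_single j (fun i _ hi => h i hi)
      (fun hh => absurd (Finset.mem_range.2 hn) hh)]
  · rw [Finset.prod_eq_one fun i hi => h i (by have := Finset.mem_range.1 hi; omega)]
    have := X_pow_dvd_iff.1 hj n (by omega)
    rw [map_sub, sub_eq_zero] at this
    exact this.symm

theorem map_seriesProd {S : Type*} [CommRing S] (f : R →+* S) (F : ℕ → PowerSeries R) :
    PowerSeries.map f (seriesProd F) = seriesProd fun i => PowerSeries.map f (F i) := by
  ext n
  rw [coeff_map, seriesProd, coeff_mk, seriesProd, coeff_mk, ← map_prod, coeff_map]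

/-- `(∏ σ_{b_i}(t^i))^a = ∏ σ_{a b_i}(t^i)`. -/
theorem powerStructure_seriesProd {σ : R → PowerSeries R} (h0 : ∀ b, coeff 0 (σ b) = 1)
    (h1 : ∀ b, coeff 1 (σ b) = b) (b : ℕ → R) (a : R) :
    powerStructure σ (seriesProd fun i => expand (i + 1) i.succ_ne_zero (σ (b i))) a =
      seriesProd fun i => expand (i + 1) i.succ_ne_zero (σ (a * b i)) := by
  rw [powerStructure]
  congr 1
  funext i
  rw [eulerExponent_eq_of_coeff h0 h1 rfl]

theorem seriesProd_expand_single {σ : R → PowerSeries R} (hz : σ 0 = 1)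
    (h0 : ∀ b, coeff 0 (σ b) = 1) (h1 : ∀ b, coeff 1 (σ b) = b) (j : ℕ) (b : R) :
    (seriesProd fun i => expand (i + 1) i.succ_ne_zero (σ (if i = j then b else 0))) =
      expand (j + 1) j.succ_ne_zero (σ b) := by
  have hj : expand (j + 1) j.succ_ne_zero (σ b) =
      expand (j + 1) j.succ_ne_zero (σ (if j = j then b else 0)) := by rw [if_pos rfl]
  rw [hj]
  refine seriesProd_eq_of_single
    (F := fun i => expand (i + 1) i.succ_ne_zero (σ (if i = j then b else 0))) j
    (fun i hi => ?_) ?_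
  · simp only [if_neg hi, hz, map_one]
  · obtain ⟨w, hw⟩ := X_pow_succ_dvd_expand_sub (h0 b) (h1 b) j
    simp only [if_pos]
    refine ⟨X * w + C b, ?_⟩
    linear_combination hw

/-- `σ_b(t^j)^a = σ_{ab}(t^j)`. -/
theorem powerStructure_expand {σ : R → PowerSeries R} (hz : σ 0 = 1)
    (h0 : ∀ b, coeff 0 (σ b) = 1) (h1 : ∀ b, coeff 1 (σ b) = b) (j : ℕ) (a b : R) :
    powerStructure σ (expand (j + 1) j.succ_ne_zero (σ b)) a =
      expand (j + 1) j.succ_ne_zero (σ (a * b)) := by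
  rw [← seriesProd_expand_single hz h0 h1 j b, powerStructure_seriesProd h0 h1,
    ← seriesProd_expand_single hz h0 h1 j (a * b)]
  congr 1
  funext i
  split_ifs <;> simp

end PowerStructure

/-! ### The pre-`λ`-structure on the Burnside ring -/

namespace BurnsideRing

open PowerSeries

variable {G : Type u} [Group G]

/-- The Burnside ring is generated, as an abelian group, by the classes of finite `G`-sets. -/
theorem mem_of_forall_of_mem (S : AddSubgroup (BurnsideRing G)) (h : ∀ a, of a ∈ S)
    (b : BurnsideRing G) : b ∈ S := by
  refine TensorProduct.induction_on (motive := fun b : ℤ ⊗[ℕ] FinGSetClass G => b ∈ S) b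
    S.zero_mem (fun n a => ?_) fun x y hx hy => S.add_mem hx hy
  have e : (n ⊗ₜ[ℕ] a : ℤ ⊗[ℕ] FinGSetClass G) = n • (of a : BurnsideRing G) := by
    rw [of_apply]
    refine Eq.trans ?_ (TensorProduct.smul_tmul' n (1 : ℤ) a).symm
    simp
  rw [e]
  exact S.zsmul_mem (h a) n

theorem exists_eq_of_sub_of (b : BurnsideRing G) : ∃ x y : FinGSetClass G, b = of x - of y := by
  let S : AddSubgroup (BurnsideRing G) :=
    { carrier := {b | ∃ x y : FinGSetClass G, b = of x - of y}
      zero_mem' := ⟨0, 0, by simp⟩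
      add_mem' := by
        rintro _ _ ⟨x, y, rfl⟩ ⟨x', y', rfl⟩
        exact ⟨x + x', y + y', by rw [map_add, map_add]; ring⟩
      neg_mem' := by
        rintro _ ⟨x, y, rfl⟩
        exact ⟨y, x, by ring⟩ }
  exact mem_of_forall_of_mem S (fun a => ⟨a, 0, by simp⟩) b

theorem sigma_zero : sigma (0 : BurnsideRing G) = 1 := by
  rw [sigma, map_zero]; rfl

theorem sigma_add (a b : BurnsideRing G) : sigma (a + b) = sigma a * sigma b := by
  rw [sigma, map_add]; rfl

theorem sym_one (a : FinGSetClass G) : FinGSetClass.sym 1 a = a := by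
  induction a using Quotient.ind with | _ A
  refine FinGSetClass.mk_eq (FinGSet.Iso.symm ⟨Sym.oneEquiv, fun g a => ?_⟩)
  rfl

theorem sym_point (n : ℕ) : FinGSetClass.sym n (1 : FinGSetClass G) = 1 := by
  refine FinGSetClass.mk_eq ⟨⟨fun _ => PUnit.unit, fun _ => Sym.replicate n PUnit.unit,
    fun x => ?_, fun _ => rfl⟩, fun _ _ => rfl⟩
  have : Subsingleton (Sym PUnit n) := inferInstance
  exact this.elim _ _

/-- `σ_b(t) = 1 + b t + ⋯` for virtual `G`-sets `b` too: the condition defines a subgroup. -/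
theorem coeff_sigma (b : BurnsideRing G) : coeff 0 (sigma b) = 1 ∧ coeff 1 (sigma b) = b := by
  have hmul0 : ∀ f g : PowerSeries (BurnsideRing G), coeff 0 (f * g) = coeff 0 f * coeff 0 g :=
    fun f g => by simp
  have hz : ∀ b : BurnsideRing G, coeff 0 (sigma b) = 1 → coeff 0 (sigma (-b)) = 1 := by
    intro b hb
    have h : sigma b * sigma (-b) = 1 := by rw [← sigma_add, add_neg_cancel, sigma_zero]
    have := congrArg (coeff 0) h
    rwa [hmul0, hb, one_mul, coeff_zero_one] at this
  have hmul : ∀ f g : PowerSeries (BurnsideRing G), coeff 0 f = 1 → coeff 0 g = 1 →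
      coeff 1 (f * g) = coeff 1 f + coeff 1 g := by
    intro f g hf hg
    rw [coeff_mul, Finset.Nat.antidiagonal_succ]
    simp [hf, hg, add_comm]
  let S : AddSubgroup (BurnsideRing G) :=
    { carrier := {b | coeff 0 (sigma b) = 1 ∧ coeff 1 (sigma b) = b}
      zero_mem' := by
        constructor <;> simp [sigma_zero, coeff_one]
      add_mem' := by
        rintro a b ⟨ha0, ha1⟩ ⟨hb0, hb1⟩
        refine ⟨?_, ?_⟩
        · rw [sigma_add, hmul0, ha0, hb0, one_mul]
        · rw [sigma_add, hmul _ _ ha0 hb0, ha1, hb1]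
      neg_mem' := by
        rintro b ⟨hb0, hb1⟩
        refine ⟨hz b hb0, ?_⟩
        have h : sigma b * sigma (-b) = 1 := by rw [← sigma_add, add_neg_cancel, sigma_zero]
        have h1 := congrArg (coeff 1) h
        rw [hmul _ _ hb0 (hz b hb0), hb1, coeff_one, if_neg one_ne_zero] at h1
        exact eq_neg_of_add_eq_zero_right h1 }
  refine mem_of_forall_of_mem S (fun a => ?_) b
  constructor
  · rw [sigma_of, symSeries, coeff_mk, FinGSetClass.sym_zero, map_one]
  · rw [sigma_of, symSeries, coeff_mk, sym_one]

/-- `σ_1(t) = 1 / (1 - t)`. -/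
theorem sigma_one_mul : sigma (1 : BurnsideRing G) * (1 - X) = 1 := by
  rw [← map_one of, sigma_of]
  have h : symSeries (1 : FinGSetClass G) = PowerSeries.mk fun _ => 1 := by
    ext n
    rw [symSeries, coeff_mk, coeff_mk, sym_point, map_one]
  exact h ▸ mk_one_mul_one_sub_eq_one (BurnsideRing G)

/-- `σ_n(t) = (1 - t)^{-n}` for an integer `n`. -/
theorem map_oneSubPow_zpow (i : ℕ) (n : ℤ) :
    PowerSeries.map (Int.castRingHom (BurnsideRing G))
      ((oneSubPow i ^ (-n) : (PowerSeries ℤ)ˣ) : PowerSeries ℤ) =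
      expand (i + 1) i.succ_ne_zero (sigma (n : BurnsideRing G)) := by
  let U : (PowerSeries (BurnsideRing G))ˣ :=
    Units.map (PowerSeries.map (Int.castRingHom (BurnsideRing G))).toMonoidHom (oneSubPow i)
  let E : (PowerSeries (BurnsideRing G))ˣ →* (PowerSeries (BurnsideRing G))ˣ :=
    Units.map (expand (i + 1) i.succ_ne_zero :
      PowerSeries (BurnsideRing G) →ₐ[BurnsideRing G] _).toRingHom.toMonoidHom
  have hUV : U⁻¹ = E (sigmaHom 1).toMul := by
    refine inv_eq_of_mul_eq_one_right (Units.ext ?_)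
    have h := congrArg (expand (i + 1) i.succ_ne_zero) (sigma_one_mul (G := G))
    rw [map_mul, map_sub, map_one, expand_X, mul_comm] at h
    refine Eq.trans ?_ h
    refine congrArg (· * expand (i + 1) i.succ_ne_zero (sigma (1 : BurnsideRing G))) ?_
    change PowerSeries.map (Int.castRingHom (BurnsideRing G)) (1 - X ^ (i + 1)) = _
    simp
  have hn : (sigmaHom (n : BurnsideRing G)).toMul = (sigmaHom (1 : BurnsideRing G)).toMul ^ n := by
    rw [← toMul_zsmul, ← map_zsmul, zsmul_one]
  calc _ = ((U ^ (-n) : (PowerSeries (BurnsideRing G))ˣ) : PowerSeries (BurnsideRing G)) := by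
        rw [← map_zpow]; rfl
    _ = (E (sigmaHom (n : BurnsideRing G)).toMul : (PowerSeries (BurnsideRing G))ˣ) := by
        rw [hn, map_zpow, ← hUV, inv_zpow']
    _ = _ := rfl

/-- `(1 - t^{i+1})^{-a} = σ_a(t^{i+1})`. -/
theorem pow_one_sub_X_pow (i : ℕ) (a : BurnsideRing G) :
    pow (1 - X ^ (i + 1)) (-a) = expand (i + 1) i.succ_ne_zero (sigma a) := by
  have h := map_oneSubPow_zpow (G := G) i (-1)
  have h1 : PowerSeries.map (Int.castRingHom (BurnsideRing G))
      ((oneSubPow i ^ (-(-1 : ℤ)) : (PowerSeries ℤ)ˣ) : PowerSeries ℤ) = 1 - X ^ (i + 1) := by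
    rw [neg_neg, zpow_one]
    change PowerSeries.map (Int.castRingHom (BurnsideRing G)) (1 - X ^ (i + 1)) = _
    simp
  rw [← h1, h, pow, powerStructure_expand sigma_zero (fun b => (coeff_sigma b).1)
    (fun b => (coeff_sigma b).2)]
  simp

/-- `(∏ (1 - t^i)^{-q_i})^a = ∏ (1 - t^i)^{-q_i a}` for integers `q_i`. -/
theorem pow_map_seriesProd_oneSubPow (q : ℕ → ℤ) (a : BurnsideRing G) :
    pow (PowerSeries.map (Int.castRingHom (BurnsideRing G))
      (seriesProd fun i => ((oneSubPow i ^ (-q i) : (PowerSeries ℤ)ˣ) : PowerSeries ℤ))) a =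
      seriesProd fun i => pow (1 - X ^ (i + 1)) (-(q i • a)) := by
  simp only [map_seriesProd, map_oneSubPow_zpow, pow_one_sub_X_pow]
  rw [pow, powerStructure_seriesProd (fun b => (coeff_sigma b).1) (fun b => (coeff_sigma b).2)]
  simp only [zsmul_eq_mul, mul_comm a]

end BurnsideRing

/-! ### Primitive parts -/

/-- The equations `L_m = ∑_{i ∣ m} s_i` for `m ≥ 1` determine the `s_m` with `m ≥ 1`; the values of
`L` and `s` at `0` play no role. -/
theorem primitivePart_unique {M : Type*} [AddCommGroup M] {L s : ℕ → M}
    (h : ∀ m, m ≠ 0 → ∑ i ∈ m.divisors, s i = L m) {m : ℕ} (hm : m ≠ 0) :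
    s m = primitivePart L m := by
  induction m using Nat.strong_induction_on with
  | _ m ih =>
    have h1 := h m hm
    rw [← sum_primitivePart L hm, ← Nat.cons_self_properDivisors hm, Finset.sum_cons,
      Finset.sum_cons] at h1
    have h2 : ∑ i ∈ m.properDivisors, s i = ∑ i ∈ m.properDivisors, primitivePart L i :=
      Finset.sum_congr rfl fun i hi =>
        ih i (Nat.mem_properDivisors.1 hi).2 (Nat.pos_of_mem_properDivisors hi).ne'
    rw [h2] at h1
    exact add_right_cancel h1

theorem primitivePart_congr {M : Type*} [AddCommGroup M] {L L' : ℕ → M}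
    (h : ∀ m, m ≠ 0 → L m = L' m) {m : ℕ} (hm : m ≠ 0) :
    primitivePart L m = primitivePart L' m :=
  primitivePart_unique (fun k hk => (sum_primitivePart L hk).trans (h k hk)) hm

theorem primitivePart_map {M N : Type*} [AddCommGroup M] [AddCommGroup N] (f : M →+ N)
    (L : ℕ → M) {m : ℕ} (hm : m ≠ 0) :
    primitivePart (fun k => f (L k)) m = f (primitivePart L m) :=
  (primitivePart_unique (s := fun k => f (primitivePart L k))
    (fun k hk => by rw [← map_sum, sum_primitivePart L hk]) hm).symm

theorem primitivePart_sum {M ι : Type*} [AddCommGroup M] (s : Finset ι) (L : ι → ℕ → M)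
    {m : ℕ} (hm : m ≠ 0) :
    primitivePart (fun k => ∑ j ∈ s, L j k) m = ∑ j ∈ s, primitivePart (L j) m :=
  (primitivePart_unique (s := fun k => ∑ j ∈ s, primitivePart (L j) k)
    (fun k hk => by
      rw [Finset.sum_comm]
      exact Finset.sum_congr rfl fun j _ => sum_primitivePart (L j) hk) hm).symm

theorem primitivePart_add {M : Type*} [AddCommGroup M] (L L' : ℕ → M) {m : ℕ} (hm : m ≠ 0) :
    primitivePart (fun k => L k + L' k) m = primitivePart L m + primitivePart L' m :=
  (primitivePart_unique (s := fun k => primitivePart L k + primitivePart L' k)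
    (fun k hk => by
      rw [Finset.sum_add_distrib, sum_primitivePart L hk, sum_primitivePart L' hk]) hm).symm

/-! ### Logarithmic derivatives of integral power series -/

section LogDeriv

open PowerSeries

/-- The logarithmic derivative `u ↦ t u' / u`, from the multiplicative group of invertible
power series to the additive group of power series. -/
def xLogDeriv : (PowerSeries ℤ)ˣ →* Multiplicative (PowerSeries ℤ) :=
  MonoidHom.mk' (fun u => Multiplicative.ofAdd
      (X * d⁄dX ℤ (u : PowerSeries ℤ) * ((u⁻¹ : (PowerSeries ℤ)ˣ) : PowerSeries ℤ))) <| by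
    intro u v
    rw [← ofAdd_add]
    congr 1
    rw [Units.val_mul, Derivation.leibniz, mul_inv, Units.val_mul, smul_eq_mul, smul_eq_mul]
    linear_combination
      (X * d⁄dX ℤ (v : PowerSeries ℤ) * ((v⁻¹ : (PowerSeries ℤ)ˣ) : PowerSeries ℤ)) * u.mul_inv +
      (X * d⁄dX ℤ (u : PowerSeries ℤ) * ((u⁻¹ : (PowerSeries ℤ)ˣ) : PowerSeries ℤ)) * v.mul_inv

theorem xLogDeriv_eq_of_mul_eq {u : (PowerSeries ℤ)ˣ} {T : PowerSeries ℤ}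
    (h : X * d⁄dX ℤ (u : PowerSeries ℤ) = T * (u : PowerSeries ℤ)) : (xLogDeriv u).toAdd = T := by
  change X * d⁄dX ℤ (u : PowerSeries ℤ) * ((u⁻¹ : (PowerSeries ℤ)ˣ) : PowerSeries ℤ) = T
  rw [h, mul_assoc, u.mul_inv, mul_one]

/-- The logarithmic derivative of `1 - t^k` is `-k (t^k + t^{2k} + ⋯)`. -/
theorem coeff_xLogDeriv_oneSubPow (i n : ℕ) (hn : n ≠ 0) :
    coeff n (xLogDeriv (oneSubPow i)).toAdd = if i + 1 ∣ n then -((i : ℤ) + 1) else 0 := by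
  have h : (xLogDeriv (oneSubPow i)).toAdd =
      mk fun n => if i + 1 ∣ n ∧ n ≠ 0 then -((i : ℤ) + 1) else 0 := by
    apply xLogDeriv_eq_of_mul_eq
    change X * d⁄dX ℤ (1 - X ^ (i + 1) : PowerSeries ℤ) = _ * (1 - X ^ (i + 1) : PowerSeries ℤ)
    have h1 : X * d⁄dX ℤ (1 - X ^ (i + 1) : PowerSeries ℤ) =
        C (-((i : ℤ) + 1)) * X ^ (i + 1) := by
      rw [map_sub, derivative_pow, derivative_X, derivative_one]
      simp
      ring
    rw [h1]
    ext k
    rw [mul_sub, mul_one, map_sub, coeff_C_mul, coeff_X_pow, coeff_mul_X_pow', coeff_mk]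
    rcases lt_trichotomy k (i + 1) with hk | rfl | hk
    · have : ¬ (i + 1 ∣ k ∧ k ≠ 0) := fun h => by
        have := Nat.le_of_dvd (Nat.pos_of_ne_zero h.2) h.1; omega
      rw [if_neg hk.ne, if_neg this, if_neg (by omega)]; simp
    · simp
    · have e : (i + 1 ∣ k ∧ k ≠ 0) ↔ (i + 1 ∣ k - (i + 1) ∧ k - (i + 1) ≠ 0) := by
        constructor
        · rintro ⟨h, -⟩; exact ⟨Nat.dvd_sub h dvd_rfl, by omega⟩
        · rintro ⟨h, -⟩; exact ⟨(Nat.dvd_sub_iff_left hk.le dvd_rfl).1 h, by omega⟩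
      rw [if_neg hk.ne', if_pos hk.le, coeff_mk]
      simp only [e, mul_zero, sub_self]
  rw [h, coeff_mk]
  simp [hn]

theorem primitivePart_coeff_xLogDeriv_oneSubPow (i : ℕ) {m : ℕ} (hm : m ≠ 0) :
    primitivePart (fun n => coeff n (xLogDeriv (oneSubPow i)).toAdd) m =
      if m = i + 1 then -((i : ℤ) + 1) else 0 := by
  refine (primitivePart_unique (s := fun m => if m = i + 1 then -((i : ℤ) + 1) else 0)
    (fun k hk => ?_) hm).symm
  rw [coeff_xLogDeriv_oneSubPow i k hk, Finset.sum_ite_eq']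
  simp [hk]

/-- `(1 - t^{i+1})^a ≡ 1 - a t^{i+1}` modulo `t^{i+2}`, for any integer `a`. -/
theorem X_pow_dvd_oneSubPow_zpow_sub (i : ℕ) (a : ℤ) :
    (X ^ (i + 2) : PowerSeries ℤ) ∣
      ((oneSubPow i ^ a : (PowerSeries ℤ)ˣ) : PowerSeries ℤ) - (1 - C a * X ^ (i + 1)) := by
  have hX : ((oneSubPow i : (PowerSeries ℤ)ˣ) : PowerSeries ℤ) = 1 - X ^ (i + 1) := rfl
  induction a using Int.induction_on with
  | zero => simp
  | succ n ih =>
    obtain ⟨w, hw⟩ := ih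
    refine ⟨w * (1 - X ^ (i + 1)) + C (n : ℤ) * X ^ i, ?_⟩
    rw [zpow_add_one, Units.val_mul, hX, sub_eq_iff_eq_add.1 hw]
    simp only [map_add, map_one]
    ring
  | pred n ih =>
    obtain ⟨w, hw⟩ := ih
    have hu : (1 - X ^ (i + 1) : PowerSeries ℤ) *
        (((oneSubPow i)⁻¹ : (PowerSeries ℤ)ˣ) : PowerSeries ℤ) = 1 := by
      rw [← hX]; exact (oneSubPow i).mul_inv
    refine ⟨(((oneSubPow i)⁻¹ : (PowerSeries ℤ)ˣ) : PowerSeries ℤ) *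
      (w + C ((n : ℤ) + 1) * X ^ i), ?_⟩
    rw [zpow_sub_one, Units.val_mul, sub_eq_iff_eq_add.1 hw]
    simp only [map_sub, map_neg, map_add, map_one]
    linear_combination (1 + (C (n : ℤ) + 1) * X ^ (i + 1) : PowerSeries ℤ) * hu

/-- The logarithmic derivative of a series in `1 + t ℤ[[t]]` satisfies Dold's congruences: such a
series is, up to any order, a product of powers of the `1 - t^k`, for which they are clear. -/
theorem dvd_primitivePart_coeff_xLogDeriv {m : ℕ} (hm : m ≠ 0) (u : (PowerSeries ℤ)ˣ)
    (hu : (X : PowerSeries ℤ) ∣ u - 1) :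
    (m : ℤ) ∣ primitivePart (fun n => coeff n (xLogDeriv u).toAdd) m := by
  suffices H : ∀ j ≤ m, ∀ u : (PowerSeries ℤ)ˣ, (X ^ (m - j + 1) : PowerSeries ℤ) ∣ u - 1 →
      (m : ℤ) ∣ primitivePart (fun n => coeff n (xLogDeriv u).toAdd) m from
    H m le_rfl u (by simpa using hu)
  intro j
  induction j with
  | zero =>
    -- if `u ≡ 1` modulo `t^{m+1}`, then `t u' / u ≡ 0` and the primitive parts up to `m` vanish
    rintro - u ⟨w, hw⟩
    have h : X * d⁄dX ℤ (u : PowerSeries ℤ) * ((u⁻¹ : (PowerSeries ℤ)ˣ) : PowerSeries ℤ) =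
        X ^ (m + 1) * ((((m + 1 : ℕ) : PowerSeries ℤ) * w + X * d⁄dX ℤ w) *
          ((u⁻¹ : (PowerSeries ℤ)ˣ) : PowerSeries ℤ)) := by
      rw [sub_eq_iff_eq_add.1 hw]
      simp only [map_add, Derivation.leibniz, derivative_pow, derivative_X, derivative_one,
        smul_eq_mul, Nat.sub_zero]
      simp only [Nat.add_sub_cancel]
      ring
    have h0 : ∀ n ≤ m, coeff n (xLogDeriv u).toAdd = 0 := fun n hn =>
      X_pow_dvd_iff.1 (Dvd.intro _ h.symm) n (by omega)
    rw [primitivePart]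
    simp only [h0 m le_rfl, zero_sub]
    have h1 : ∀ k ≤ m, k ≠ 0 →
        primitivePart (fun n => coeff n (xLogDeriv u).toAdd) k = 0 := by
      intro k
      induction k using Nat.strong_induction_on with
      | _ k ih =>
        intro hk hk0
        rw [primitivePart, h0 k hk, Finset.sum_eq_zero, sub_zero]
        rintro ⟨i, hi⟩ -
        have := (Nat.mem_properDivisors.1 hi).2
        exact ih i this (by omega) (Nat.pos_of_mem_properDivisors hi).ne'
    rw [Finset.sum_eq_zero, neg_zero]
    · exact dvd_zero _
    · rintro ⟨i, hi⟩ -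
      have := (Nat.mem_properDivisors.1 hi).2
      exact h1 i (by omega) (Nat.pos_of_mem_properDivisors hi).ne'
  | succ j ih =>
    rintro hj u ⟨w, hw⟩
    obtain ⟨i, hi⟩ : ∃ i, m - j = i + 1 := ⟨m - j - 1, by omega⟩
    have hi' : m - (j + 1) + 1 = i + 1 := by omega
    rw [hi'] at hw
    -- the exponent is chosen to cancel the coefficient of `t^{i+1}` in `u`
    set a : ℤ := constantCoeff w with ha
    obtain ⟨w', hw'⟩ : (X : PowerSeries ℤ) ∣ w - C a := by
      rw [X_dvd_iff]; simp [ha]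
    obtain ⟨v, hv⟩ := X_pow_dvd_oneSubPow_zpow_sub i a
    have h1 := ih (by omega) (u * oneSubPow i ^ a) (by
      rw [hi, Units.val_mul, sub_eq_iff_eq_add.1 hw, sub_eq_iff_eq_add.1 hv,
        sub_eq_iff_eq_add.1 hw']
      refine ⟨v * (1 + X ^ (i + 1) * (X * w' + C a)) + w' - C a * X ^ i * (X * w' + C a), ?_⟩
      ring)
    have h2 : (fun n => coeff n (xLogDeriv (u * oneSubPow i ^ a)).toAdd) = fun n =>
        coeff n (xLogDeriv u).toAdd +
          (zmultiplesHom ℤ a) (coeff n (xLogDeriv (oneSubPow i)).toAdd) := by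
      funext n
      rw [map_mul, map_zpow, toAdd_mul, toAdd_zpow, map_add, map_zsmul]
      simp [mul_comm]
    rw [h2, primitivePart_add _ _ hm, primitivePart_map _ _ hm,
      primitivePart_coeff_xLogDeriv_oneSubPow i hm] at h1
    refine (dvd_add_left ?_).1 h1
    split_ifs with h
    · refine Dvd.intro (-a) ?_
      simp [h]
      ring
    · simp

end LogDeriv

/-! ### Dold's congruences for traces of powers -/

section Trace

open PowerSeries Matrix

theorem Derivation.leibniz_finset_prod {R S ι : Type*} [CommRing R] [CommRing S] [Algebra R S]
    [DecidableEq ι] (D : Derivation R S S) (f : ι → S) (s : Finset ι) :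
    D (∏ i ∈ s, f i) = ∑ i ∈ s, (∏ j ∈ s.erase i, f j) * D (f i) := by
  induction s using Finset.induction_on with
  | empty => simp
  | insert a s ha ih =>
    rw [Finset.prod_insert ha, D.leibniz, ih, Finset.sum_insert ha, Finset.erase_insert ha,
      smul_eq_mul, smul_eq_mul, Finset.mul_sum, add_comm]
    congr 1
    refine Finset.sum_congr rfl fun i hi => ?_
    have hai : a ≠ i := fun h => ha (h ▸ hi)
    rw [Finset.erase_insert_of_ne hai, Finset.prod_insert (fun h => ha (Finset.mem_of_mem_erase h)),
      mul_assoc]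

/-- Jacobi's formula for the derivative of a determinant. -/
theorem Derivation.det_eq_trace_adjugate_mul {R S n : Type*} [CommRing R] [CommRing S]
    [Algebra R S] [Fintype n] [DecidableEq n] (D : Derivation R S S) (M : Matrix n n S) :
    D M.det = (M.adjugate * M.map D).trace := by
  have h : ∀ i, (M.adjugate * M.map D) i i = (M.updateCol i fun j => D (M j i)).det := by
    intro i
    rw [← cramer_apply, cramer_eq_adjugate_mulVec]
    rfl
  simp only [Matrix.trace, Matrix.diag, h, det_apply', map_sum]
  rw [Finset.sum_comm]
  refine Finset.sum_congr rfl fun σ _ => ?_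
  rw [D.leibniz, D.map_intCast, smul_zero, add_zero, D.leibniz_finset_prod, smul_eq_mul,
    Finset.mul_sum]
  refine Finset.sum_congr rfl fun i _ => ?_
  rw [← Finset.mul_prod_erase Finset.univ _ (Finset.mem_univ i)]
  congr 1
  rw [mul_comm, updateCol_self]
  congr 1
  refine Finset.prod_congr rfl fun j hj => ?_
  rw [updateCol_ne (Finset.ne_of_mem_erase hj)]

/-- Dold's congruences for an integral matrix: `-∑ tr(A^n) t^n` is the logarithmic derivative of
`det (1 - t A)`. -/
theorem Matrix.dvd_primitivePart_trace_pow {n : Type*} [Fintype n] [DecidableEq n]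
    (A : Matrix n n ℤ) {m : ℕ} (hm : m ≠ 0) :
    (m : ℤ) ∣ primitivePart (fun k => (A ^ k).trace) m := by
  -- `B = ∑ A^k t^k` is the inverse of `N = 1 - t A`
  let A' : Matrix n n (PowerSeries ℤ) := A.map C
  let N : Matrix n n (PowerSeries ℤ) := 1 - (X : PowerSeries ℤ) • A'
  let B : Matrix n n (PowerSeries ℤ) := Matrix.of fun i j => PowerSeries.mk fun k => (A ^ k) i j
  have hBA : ∀ i j, (B * A') i j = PowerSeries.mk fun k => (A ^ (k + 1)) i j := by
    intro i j
    ext k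
    simp only [Matrix.mul_apply, A', B, pow_succ, Matrix.of_apply, Matrix.map_apply, map_sum,
      coeff_mul_C, coeff_mk]
  have hXBA : (X : PowerSeries ℤ) • (B * A') = B - 1 := by
    ext i j k
    rw [Matrix.smul_apply, hBA, smul_eq_mul, Matrix.sub_apply]
    cases k with
    | zero => simp [B, Matrix.one_apply]
    | succ k =>
      simp [coeff_succ_X_mul, B, Matrix.one_apply]; split_ifs <;> simp [coeff_one]
  have hBN : B * N = 1 := by
    rw [mul_sub, mul_one, Matrix.mul_smul, hXBA, sub_sub_cancel]
  have hadj : N.adjugate = N.det • B := by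
    calc N.adjugate = (B * N) * N.adjugate := by rw [hBN, one_mul]
      _ = N.det • B := by rw [mul_assoc, mul_adjugate, Matrix.mul_smul, mul_one]
  have hDN : N.map (d⁄dX ℤ) = -A' := by
    ext1 i j
    have h1 : d⁄dX ℤ ((1 : Matrix n n (PowerSeries ℤ)) i j) = 0 := by
      rw [Matrix.one_apply]; split_ifs <;> simp
    simp only [N, A', Matrix.map_apply, Matrix.sub_apply, Matrix.smul_apply, smul_eq_mul,
      Matrix.neg_apply, map_sub, h1, Derivation.leibniz, derivative_X, derivative_C]
    simp
  have hdet : constantCoeff N.det = 1 := by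
    rw [RingHom.map_det, ← det_one (n := n) (R := ℤ)]
    congr 1
    ext i j
    simp only [N, RingHom.mapMatrix_apply, Matrix.map_apply, Matrix.sub_apply, Matrix.smul_apply,
      smul_eq_mul, map_sub, map_mul, constantCoeff_X, zero_mul, sub_zero, Matrix.one_apply]
    split_ifs <;> simp
  have hu : IsUnit N.det := by
    rw [PowerSeries.isUnit_iff_constantCoeff, hdet]; exact isUnit_one
  obtain ⟨u, hu⟩ := hu
  have hlog : (xLogDeriv u).toAdd = -((X : PowerSeries ℤ) • (B * A')).trace := by
    apply xLogDeriv_eq_of_mul_eq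
    rw [hu, Derivation.det_eq_trace_adjugate_mul, hDN, hadj, Matrix.smul_mul, mul_neg,
      Matrix.trace_smul, Matrix.trace_neg, Matrix.trace_smul, smul_eq_mul, smul_eq_mul]
    ring
  have hcoeff : ∀ k, k ≠ 0 → coeff k (xLogDeriv u).toAdd = -(A ^ k).trace := by
    intro k hk
    obtain ⟨k, rfl⟩ := Nat.exists_eq_succ_of_ne_zero hk
    rw [hlog, Matrix.trace_smul, smul_eq_mul, map_neg, coeff_succ_X_mul, Matrix.trace, map_sum]
    simp [hBA, Matrix.trace]
  have h := dvd_primitivePart_coeff_xLogDeriv hm u (by rw [X_dvd_iff, map_sub, hu, hdet]; simp)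
  have hneg := primitivePart_map (negAddMonoidHom : ℤ →+ ℤ) (fun k => (A ^ k).trace) hm
  rw [primitivePart_congr hcoeff hm] at h
  simp only [coe_negAddMonoidHom] at hneg
  rw [hneg] at h
  exact (dvd_neg).1 h

/-- Dold's congruences for an endomorphism of a free abelian group of finite rank. -/
theorem LinearMap.dvd_primitivePart_trace_pow {M : Type*} [AddCommGroup M] [Module.Free ℤ M]
    [Module.Finite ℤ M] (f : Module.End ℤ M) {m : ℕ} (hm : m ≠ 0) :
    (m : ℤ) ∣ primitivePart (fun k => LinearMap.trace ℤ M (f ^ k)) m := by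
  classical
  let b := Module.Free.chooseBasis ℤ M
  have h : (fun k => LinearMap.trace ℤ M (f ^ k)) =
      fun k => (LinearMap.toMatrix b b f ^ k).trace := by
    funext k
    rw [LinearMap.trace_eq_matrix_trace ℤ b, LinearMap.toMatrix_pow]
  rw [h]
  exact Matrix.dvd_primitivePart_trace_pow _ hm

end Trace

/-! ### Marks and torsion-freeness of the Burnside ring -/

namespace FinGSet

variable {G : Type u} [Group G]

/-- The mark `|A^K|`, the number of points of the finite `G`-set `A` fixed by the subgroup `K`. -/
def mark (K : Subgroup G) (A : FinGSet G) : ℕ := Nat.card {a : A.carrier // ∀ g ∈ K, g • a = a}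

theorem Iso.mark_eq {A B : FinGSet G} (K : Subgroup G) : Iso A B → mark K A = mark K B := by
  rintro ⟨e, he⟩
  refine Nat.card_congr (e.subtypeEquiv fun a => forall₂_congr fun g _ => ?_)
  rw [← he, e.apply_eq_iff_eq]

theorem mark_sum (K : Subgroup G) (A B : FinGSet G) :
    mark K (sum A B) = mark K A + mark K B := by
  rw [mark, mark, mark, ← Nat.card_sum]
  refine Nat.card_congr ((Equiv.subtypeSum).trans (Equiv.sumCongr ?_ ?_))
  · exact Equiv.subtypeEquivRight fun a => forall₂_congr fun g _ => Sum.inl_injective.eq_iff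
  · exact Equiv.subtypeEquivRight fun a => forall₂_congr fun g _ => Sum.inr_injective.eq_iff

theorem mark_bot (A : FinGSet G) : mark ⊥ A = Nat.card A.carrier :=
  Nat.card_congr (Equiv.subtypeUnivEquiv fun a g hg => by
    rw [Subgroup.mem_bot.1 hg, one_smul])

theorem mark_ne_zero_iff {K : Subgroup G} {A : FinGSet G} :
    mark K A ≠ 0 ↔ ∃ a : A.carrier, K ≤ MulAction.stabilizer G a := by
  rw [mark, ← Nat.pos_iff_ne_zero, Nat.card_pos_iff, nonempty_subtype]
  exact ⟨fun h => h.1, fun h => ⟨h, inferInstance⟩⟩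

/-- The complement of the orbit of `a` in `A`. -/
def compl (A : FinGSet G) (a : A.carrier) : FinGSet G :=
  A.sub (fun x => x ∉ MulAction.orbit G a) fun g x h hx => h (by
    have h1 := MulAction.mem_orbit_of_mem_orbit g⁻¹ hx
    rwa [inv_smul_smul] at h1)

variable [Finite G]

theorem iso_sum_compl (A : FinGSet G) (a : A.carrier) :
    Iso A (sum (coset (MulAction.stabilizer G a)) (compl A a)) := by
  classical
  refine Iso.symm ⟨((MulAction.orbitEquivQuotientStabilizer G a).symm.sumCongr
    (Equiv.refl _)).trans (Equiv.sumCompl (· ∈ MulAction.orbit G a)), ?_⟩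
  rintro g (x | x)
  · exact MulAction.ofQuotientStabilizer_smul G a g x
  · rfl

theorem mark_compl (K : Subgroup G) (A : FinGSet G) (a : A.carrier) :
    mark K A = mark K (coset (MulAction.stabilizer G a)) + mark K (compl A a) := by
  rw [(iso_sum_compl A a).mark_eq, mark_sum]

/-- Burnside's theorem: a finite `G`-set is determined up to isomorphism by its marks. Two points
whose stabilizer is a maximal subgroup with nonzero mark have isomorphic orbits, which can be
removed. -/
theorem iso_of_mark_eq (A B : FinGSet G) (h : ∀ K, mark K A = mark K B) : Iso A B := by
  induction hn : Nat.card A.carrier using Nat.strong_induction_on generalizing A B with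
  | _ n ih =>
    have hcard : Nat.card A.carrier = Nat.card B.carrier := by rw [← mark_bot, h, mark_bot]
    rcases isEmpty_or_nonempty A.carrier with hA | ⟨⟨a₀⟩⟩
    · have hB : IsEmpty B.carrier := by
        rw [← Finite.card_eq_zero_iff, ← hcard, Finite.card_eq_zero_iff]
        exact hA
      exact ⟨Equiv.equivOfIsEmpty _ _, fun g a => isEmptyElim a⟩
    · obtain ⟨K, hK⟩ := (Set.toFinite {K : Subgroup G | mark K A ≠ 0}).exists_maximal
        ⟨_, mark_ne_zero_iff.2 ⟨a₀, le_rfl⟩⟩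
      obtain ⟨a, ha⟩ := mark_ne_zero_iff.1 hK.prop
      obtain ⟨b, hb⟩ := mark_ne_zero_iff.1 ((h K).symm.trans_ne hK.prop)
      have ha' : MulAction.stabilizer G a = K :=
        le_antisymm (hK.le_of_ge (mark_ne_zero_iff.2 ⟨a, le_rfl⟩) ha) ha
      have hb' : MulAction.stabilizer G b = K :=
        le_antisymm (hK.le_of_ge ((h _).trans_ne (mark_ne_zero_iff.2 ⟨b, le_rfl⟩)) hb) hb
      refine (iso_sum_compl A a).trans (Iso.trans ?_ (iso_sum_compl B b).symm)
      rw [ha', hb']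
      refine (Iso.refl _).sum (ih (Nat.card (compl A a).carrier) ?_ _ _ (fun L => ?_) rfl)
      · rw [← hn]
        exact Finite.card_subtype_lt (x := a) fun h => h (MulAction.mem_orbit_self a)
      · have hL := h L
        rw [mark_compl L A a, mark_compl L B b, ha', hb'] at hL
        exact Nat.add_left_cancel hL

end FinGSet

namespace BurnsideRing

variable {G : Type u} [Group G]

/-- The mark `[A] ↦ |A^K|` on classes of finite `G`-sets. -/
def classMark (K : Subgroup G) : FinGSetClass G →+ ℤ where
  toFun := Quotient.lift (fun A => (FinGSet.mark K A : ℤ)) fun _ _ h => by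
    exact_mod_cast FinGSet.Iso.mark_eq K h
  map_zero' := by
    change ((FinGSet.mark K FinGSet.empty : ℕ) : ℤ) = 0
    rw [Nat.cast_eq_zero, FinGSet.mark, Finite.card_eq_zero_iff]
    exact ⟨fun a => a.1.elim⟩
  map_add' a b := by
    induction a using Quotient.ind
    induction b using Quotient.ind
    exact (congrArg Nat.cast (FinGSet.mark_sum K _ _)).trans (Nat.cast_add _ _)

/-- The mark homomorphism from the Burnside ring to the integers. -/
def mark (K : Subgroup G) : BurnsideRing G →+ ℤ :=
  TensorProduct.liftAddHom (zmultiplesHom (FinGSetClass G →+ ℤ) (classMark K))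
    fun r m n => by rw [map_nsmul, AddMonoidHom.nsmul_apply, map_nsmul]

theorem mark_of (K : Subgroup G) (A : FinGSet G) :
    mark K (of (FinGSetClass.mk A)) = FinGSet.mark K A := by
  rw [of_apply]
  refine (TensorProduct.liftAddHom_tmul _ _ (1 : ℤ) _).trans ?_
  rw [zmultiplesHom_apply, one_zsmul]
  rfl

theorem eq_zero_of_mark_eq_zero [Finite G] {b : BurnsideRing G} (h : ∀ K, mark K b = 0) :
    b = 0 := by
  obtain ⟨x, y, rfl⟩ := exists_eq_of_sub_of b
  induction x using Quotient.ind with | _ A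
  induction y using Quotient.ind with | _ B
  rw [sub_eq_zero]
  refine congrArg of (FinGSetClass.mk_eq (FinGSet.iso_of_mark_eq A B fun K => ?_))
  have hK : mark K (of (FinGSetClass.mk A) - of (FinGSetClass.mk B)) = 0 := h K
  rw [map_sub, mark_of, mark_of, sub_eq_zero] at hK
  exact_mod_cast hK

/-- The Burnside ring of a finite group is torsion-free. -/
theorem nsmul_left_injective [Finite G] {m : ℕ} (hm : m ≠ 0) {a b : BurnsideRing G}
    (h : m • a = m • b) : a = b := by
  rw [← sub_eq_zero]
  refine eq_zero_of_mark_eq_zero fun K => ?_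
  have hK := congrArg (mark K) (sub_eq_zero.2 h)
  rw [← smul_sub, map_nsmul, map_zero, nsmul_eq_mul] at hK
  exact (mul_eq_zero.1 hK).resolve_left (by exact_mod_cast hm)

theorem coset_eq_of_mk_eq [Finite G] {H K : Subgroup G} (h : ConSub.mk H = ConSub.mk K) :
    coset H = coset K := by
  obtain ⟨g, rfl⟩ := Quotient.exact h
  refine congrArg of (FinGSetClass.mk_eq (FinGSet.Iso.symm ?_))
  have hs : ∀ x y : G, (QuotientGroup.leftRel (H.map (MulAut.conj g).toMonoidHom)) x y ↔
      (QuotientGroup.leftRel H) (x * g) (y * g) := by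
    intro x y
    rw [QuotientGroup.leftRel_apply, QuotientGroup.leftRel_apply]
    constructor
    · rintro ⟨k, hk, hkx⟩
      have e : g * k * g⁻¹ = x⁻¹ * y := hkx
      have : (x * g)⁻¹ * (y * g) = k := by
        rw [mul_inv_rev, mul_assoc, ← mul_assoc x⁻¹, ← e]; group
      rwa [this]
    · intro hk
      refine ⟨_, hk, ?_⟩
      change g * ((x * g)⁻¹ * (y * g)) * g⁻¹ = x⁻¹ * y
      group
  -- `x (g H g⁻¹) ↦ x g H`
  refine ⟨Quotient.congr (Equiv.mulRight g) hs, ?_⟩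
  intro k x
  induction x using Quotient.ind with | _ x
  exact congrArg (QuotientGroup.mk (s := H)) (mul_assoc k x g)

end BurnsideRing

/-! ### Lefschetz numbers of iterates -/

section Cohomology

variable {Y : Type v} [TopologicalSpace Y]

theorem freeCohomologyMap_iterate {Φ : Supports} {Z A : Set Y} {f : Y → Y}
    (hf : IsPairMap Φ Z A f) (n m : ℕ) :
    freeCohomologyMap (hf.iterate m) n = (freeCohomologyMap hf n : Module.End ℤ _) ^ m := by
  induction m with
  | zero =>
    ext x
    rfl
  | succ m ih =>
    rw [pow_succ', ← ih]
    ext x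
    rfl

theorem lefschetz_congr {Φ : Supports} {Z Z' A A' : Set Y} {f f' : Y → Y}
    (hf : IsPairMap Φ Z A f) (hf' : IsPairMap Φ Z' A' f') (hZ : Z = Z') (hA : A = A')
    (h : f = f') : lefschetz hf = lefschetz hf' := by
  subst hZ hA h
  rfl

/-- The cohomology of the pair `(Z, Z)` vanishes. -/
theorem subsingleton_relCohomology_self (Φ : Supports) (Z : Set Y) (n : ℕ) :
    Subsingleton (RelCohomology Φ Z Z n) := by
  have h : ∀ c : cocycle Φ Z Z n, c = 0 := fun c =>
    Subtype.ext (funext fun s => c.2.1.1 s s.2)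
  have : Subsingleton (cocycle Φ Z Z n) := ⟨fun a b => (h a).trans (h b).symm⟩
  infer_instance

theorem trace_freeCohomologyMap_eq_zero {Φ : Supports} {Z A : Set Y} {f : Y → Y}
    (hf : IsPairMap Φ Z A f) (n : ℕ) [Subsingleton (RelCohomology Φ Z A n)] :
    LinearMap.trace ℤ _ (freeCohomologyMap hf n) = 0 := by
  have h : freeCohomologyMap hf n = 0 := by
    ext x
    have : Subsingleton (RelCohomology Φ Z A n ⧸
      Submodule.torsion ℤ (RelCohomology Φ Z A n)) := inferInstance
    exact Subsingleton.elim _ _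
  rw [h, map_zero]

theorem lefschetz_self {Φ : Supports} {Z : Set Y} {f : Y → Y} (hf : IsPairMap Φ Z Z f) :
    lefschetz hf = 0 := by
  refine finsum_eq_zero_of_forall_eq_zero fun n => ?_
  have := subsingleton_relCohomology_self Φ Z n
  rw [trace_freeCohomologyMap_eq_zero, mul_zero]

/-- Lefschetz numbers of iterates satisfy Dold's congruences, being alternating sums of traces of
powers of integral endomorphisms. -/
theorem dvd_primitivePart_lefschetz {Φ : Supports} {Z A : Set Y} {f : Y → Y}
    (hf : IsPairMap Φ Z A f) (hfin : FiniteCohomology Φ Z A) {m : ℕ} (hm : m ≠ 0) :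
    (m : ℤ) ∣ primitivePart (fun k => lefschetz (hf.iterate k)) m := by
  obtain ⟨hfg, N, hN⟩ := hfin
  have h : (fun k => lefschetz (hf.iterate k)) = fun k => ∑ n ∈ Finset.range N,
      AddMonoidHom.mulLeft ((-1 : ℤ) ^ n) (LinearMap.trace ℤ _
        ((freeCohomologyMap hf n : Module.End ℤ _) ^ k)) := by
    funext k
    rw [lefschetz, finsum_eq_sum_of_support_subset (s := Finset.range N)]
    · exact Finset.sum_congr rfl fun n _ => by rw [freeCohomologyMap_iterate]; rfl
    · intro n hn
      by_contra hnN
      have := hN n (by simpa using hnN)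
      exact hn (by simp only [trace_freeCohomologyMap_eq_zero, mul_zero])
  rw [h, primitivePart_sum _ _ hm]
  refine Finset.dvd_sum fun n _ => ?_
  rw [primitivePart_map _ _ hm]
  have := hfg n
  exact Dvd.dvd.mul_left (LinearMap.dvd_primitivePart_trace_pow _ hm) _

end Cohomology

/-! ### Spaces with a single orbit type -/

section Equivariant

variable {G : Type u} [Group G] {X : Type v} [MulAction G X]

theorem card_eq_of_conSub_eq {H K : Subgroup G} (h : ConSub.mk H = ConSub.mk K) :
    Nat.card H = Nat.card K := by
  obtain ⟨g, rfl⟩ := Quotient.exact h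
  exact (Subgroup.card_map_of_injective (MulAut.conj g).injective).symm

theorem fixedSet_eq_univ {H : Subgroup G}
    (hH : ∀ x : X, ConSub.mk (MulAction.stabilizer G x) = ConSub.mk H) :
    fixedSet X (ConSub.mk H) = Set.univ :=
  Set.eq_univ_of_forall fun x => ⟨_, hH x, fun _ hg => hg⟩

theorem fixedSetAbove_eq_empty [Finite G] {H : Subgroup G}
    (hH : ∀ x : X, ConSub.mk (MulAction.stabilizer G x) = ConSub.mk H) :
    fixedSetAbove X (ConSub.mk H) = ∅ := by
  rw [Set.eq_empty_iff_forall_notMem]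
  rintro x ⟨d, ⟨H', K, hH', hK, hlt⟩, L, hL, hx⟩
  -- comparison of orders: `|L| = |K| > |H'| = |G_x| ≥ |L|`
  have h1 : Nat.card L = Nat.card K := card_eq_of_conSub_eq (hL.trans hK.symm)
  have h2 : Nat.card H' = Nat.card (MulAction.stabilizer G x) :=
    card_eq_of_conSub_eq (hH'.trans (hH x).symm)
  have h3 : Nat.card L ≤ Nat.card (MulAction.stabilizer G x) := Subgroup.card_le_of_le hx
  have h4 : Nat.card H' < Nat.card K := by
    refine lt_of_le_of_ne (Subgroup.card_le_of_le hlt.le) fun h => hlt.ne ?_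
    exact Subgroup.eq_of_le_of_card_ge hlt.le h.ge
  omega

/-- For a class `c ≠ [H]`, both sets are everything if `c < [H]` and empty otherwise. -/
theorem fixedSetAbove_eq_fixedSet {H : Subgroup G}
    (hH : ∀ x : X, ConSub.mk (MulAction.stabilizer G x) = ConSub.mk H) {c : ConSub G}
    (hc : c ≠ ConSub.mk H) : fixedSetAbove X c = fixedSet X c := by
  apply Set.Subset.antisymm
  · rintro x ⟨d, ⟨H', K, hH', hK, hlt⟩, L, hL, hx⟩
    obtain ⟨g, rfl⟩ := Quotient.exact (hK.trans hL.symm)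
    refine ⟨H'.map (MulAut.conj g).toMonoidHom, ?_, fun k hk =>
      hx k (Subgroup.map_mono hlt.le hk)⟩
    rw [← hH']
    exact (Quotient.sound ⟨g, rfl⟩ : ConSub.mk H' = _).symm
  · rintro x ⟨L, rfl, hx⟩
    refine ⟨ConSub.mk H, ⟨L, MulAction.stabilizer G x, rfl, hH x, lt_of_le_of_ne hx ?_⟩,
      _, hH x, fun _ hg => hg⟩
    rintro rfl
    exact hc (hH x)

namespace IsGMap

variable [TopologicalSpace X] {Φ : Supports} {φ : X → X}

theorem orbitMap_iterate (hφ : IsGMap G Φ φ) (m : ℕ) :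
    (hφ.iterate m).orbitMap = hφ.orbitMap^[m] := by
  funext y
  induction y using Quotient.ind with | _ x
  induction m generalizing x with
  | zero => rfl
  | succ m ih => exact ih (φ x)

variable [Finite G] [ContinuousConstSMul G X]

/-- For a single orbit type, only the class of `H` contributes to the equivariant Lefschetz number:
for every other class `𝔥` the pair is of the form `(Z, Z)`. -/
theorem equivLefschetz_eq (hφ : IsGMap G Φ φ) {H : Subgroup G}
    (hH : ∀ x : X, ConSub.mk (MulAction.stabilizer G x) = ConSub.mk H) :
    hφ.equivLefschetz = lefschetz hφ.isPairMap_orbitSpace • BurnsideRing.coset H := by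
  rw [equivLefschetz, finsum_eq_single _ (ConSub.mk H)]
  · congr 1
    · refine lefschetz_congr _ _ ?_ ?_ rfl
      · rw [fixedSet_eq_univ hH, Set.image_univ]
        exact Set.range_eq_univ.2 Quotient.exists_rep
      · rw [fixedSetAbove_eq_empty hH, Set.image_empty]
    · exact BurnsideRing.coset_eq_of_mk_eq (Quotient.out_eq _)
  · intro c hc
    have h := fixedSetAbove_eq_fixedSet (X := X) hH hc
    rw [lefschetz_congr _ (hφ.isPairMap (hφ.mapsTo_fixedSet c) (hφ.mapsTo_fixedSet c)) rfl
      (by rw [h]) rfl, lefschetz_self, zero_smul]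

theorem primitiveEquivLefschetz_eq (hφ : IsGMap G Φ φ) {H : Subgroup G}
    (hH : ∀ x : X, ConSub.mk (MulAction.stabilizer G x) = ConSub.mk H) {m : ℕ} (hm : m ≠ 0) :
    hφ.primitiveEquivLefschetz m =
      primitiveLefschetz hφ.isPairMap_orbitSpace m • BurnsideRing.coset H := by
  have h : ∀ k, (hφ.iterate k).equivLefschetz =
      (zmultiplesHom (BurnsideRing G) (BurnsideRing.coset H))
        (lefschetz (hφ.isPairMap_orbitSpace.iterate k)) := fun k => by
    rw [equivLefschetz_eq _ hH, zmultiplesHom_apply,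
      lefschetz_congr _ (hφ.isPairMap_orbitSpace.iterate k) rfl rfl (hφ.orbitMap_iterate k)]
  rw [primitiveEquivLefschetz, primitivePart_congr (fun k _ => h k) hm, primitivePart_map _ _ hm]
  rfl

end IsGMap

end Equivariant

/-! ### The zeta functions -/

theorem nsmul_natQuotient {M : Type*} [AddCommGroup M] {m : ℕ} {s : M} (h : ∃ q : M, m • q = s) :
    m • natQuotient m s = s := by
  rw [natQuotient, dif_pos h]
  exact h.choose_spec

end

theorem mainTheorem6 {G : Type u} [Group G] [Finite G] {X : Type v} [TopologicalSpace X]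
    [T2Space X] [MulAction G X] [ContinuousConstSMul G X]
    (Φ : Supports) (φ : X → X) (hφ : IsGMap G Φ φ)
    (hX : FiniteCohomology Φ (Set.univ : Set (OrbitSpace G X)) ∅)
    (H : Subgroup G) (hH : ∀ x : X, ConSub.mk (MulAction.stabilizer G x) = ConSub.mk H) :
    (∀ m : ℕ, 1 ≤ m → ∃! q : ℤ, m • q = primitiveLefschetz hφ.isPairMap_orbitSpace m) ∧
    (∀ m : ℕ, 1 ≤ m → ∃! q : BurnsideRing G, m • q = hφ.primitiveEquivLefschetz m) ∧
    hφ.equivZeta =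
      BurnsideRing.pow
        (PowerSeries.map (Int.castRingHom (BurnsideRing G)) (zeta hφ.isPairMap_orbitSpace))
        (BurnsideRing.coset H) := by
  have hZ : ∀ m : ℕ, m ≠ 0 → ∃ q : ℤ, m • q = primitiveLefschetz hφ.isPairMap_orbitSpace m := by
    intro m hm
    obtain ⟨q, hq⟩ := dvd_primitivePart_lefschetz hφ.isPairMap_orbitSpace hX hm
    exact ⟨q, by rw [nsmul_eq_mul]; exact hq.symm⟩
  have hB : ∀ m : ℕ, m ≠ 0 → ∀ q : ℤ, m • q = primitiveLefschetz hφ.isPairMap_orbitSpace m →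
      m • (q • BurnsideRing.coset H) = hφ.primitiveEquivLefschetz m := by
    intro m hm q hq
    rw [hφ.primitiveEquivLefschetz_eq hH hm, ← hq, smul_assoc]
  refine ⟨fun m hm => ?_, fun m hm => ?_, ?_⟩
  · obtain ⟨q, hq⟩ := hZ m (by omega)
    exact ⟨q, hq, fun q' hq' => nsmul_right_injective (by omega) (hq'.trans hq.symm)⟩
  · obtain ⟨q, hq⟩ := hZ m (by omega)
    exact ⟨_, hB m (by omega) q hq, fun q' hq' =>
      BurnsideRing.nsmul_left_injective (by omega) (hq'.trans (hB m (by omega) q hq).symm)⟩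
  · -- factor by factor, the exponents agree by uniqueness of the quotient by `i + 1`
    rw [zeta, BurnsideRing.pow_map_seriesProd_oneSubPow, IsGMap.equivZeta]
    congr 1
    funext i
    have h := hB (i + 1) i.succ_ne_zero _ (nsmul_natQuotient (hZ (i + 1) i.succ_ne_zero))
    rw [BurnsideRing.nsmul_left_injective i.succ_ne_zero ((nsmul_natQuotient ⟨_, h⟩).trans h.symm)]
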